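/- Let $N\ge 2$, let $\Omega\subset\mathbb{R}^N$ be a bounded domain (nonempty, open, connected) with Lipschitz boundary, and let $C_+(\overline\Omega)$ be the set of continuous functions $h:\overline\Omega\to(1,\infty)$, with $h^-=\min_{\overline\Omega}h$ and $h^+=\max_{\overline\Omega}h$. Let $p\in C_+(\overline\Omega)$ with $p^-\ge 2$ be log-Hölder continuous: there is $\alpha>0$ such that $|p(x)-p(y)|\le \alpha/(-\log|x-y|)$ for all $x\ne y$ in $\Omega$ with $|x-y|\le\frac12$. Put $p'(x)=p(x)/(p(x)-1)$. For $h\in C_+(\overline\Omega)$ let $L^{h(x)}(\Omega)$ be the space of (classes of a.e. equal) measurable functions $u$ on $\Omega$ with $\rho_{h(x)}(u)=\int_\Omega|u(x)|^{h(x)}dx<\infty$, normed by $|u|_{h(x)}=\inf\{t>0:\rho_{h(x)}(u/t)\le 1\}$. Let $W^{1,p(x)}(\Omega)$ be the space of all $u\in L^{p(x)}(\Omega)$ with weak gradient $\nabla u$ satisfying $|\nabla u|\in L^{p(x)}(\Omega)$, normed by $\|u\|=|u|_{p(x)}+|\nabla u|_{p(x)}$ (where $|\nabla u|_{p(x)}$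 is the norm of the function $|\nabla u|$), and let $W^{-1,p'(x)}(\Omega)$ be its dual space with the dual norm. Let $\lambda\in\mathbb{R}$ and let $f:\Omega\times\mathbb{R}\times\mathbb{R}^N\to\mathbb{R}$ satisfy: (A1) $f$ is a Carathéodory function: $f(\cdot,\zeta,\xi)$ is measurable for all $(\zeta,\xi)\in\mathbb{R}\times\mathbb{R}^N$, and $f(x,\cdot,\cdot)$ is continuous for a.e. $x\in\Omega$; (A2) there are $\beta_1>0$, $\gamma\in L^{p'(x)}(\Omega)$ and $q\in C_+(\overline\Omega)$ with $2\le q^-\le q^+<p^-$ such that $$|f(x,\zeta,\xi)|\le\beta_1\big(\gamma(x)+|\zeta|^{q(x)-1}+|\xi|^{q(x)-1}\big)\quad\text{for a.e. }x\in\Omega\text{ and all }(\zeta,\xi)\in\mathbb{R}\times\mathbb{R}^N.$$ Then the operator $\mathcal S:W^{1,p(x)}(\Omega)\to W^{-1,p'(x)}(\Omega)$ given by $$\langle\mathcal Su,\varphi\rangle=-\int_\Omega\lambda f(x,u,\nabla u)\,\varphi\,dx\qquad\text{for all }u,\varphi\in W^{1,p(x)}(\Omega)$$ is well defined (the integrand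 is integrable and $\mathcal Su$ is a bounded linear functional) and compact, that is, it is continuous and maps bounded sets to relatively compact sets. -/

import Mathlib

open MeasureTheory Set
open scoped Topology ContDiff

noncomputable section

namespace VarExp

/-! ## Domains and exponents -/

/-- Euclidean space `ℝ^N`. -/
abbrev Rn (N : ℕ) : Type := EuclideanSpace ℝ (Fin N)

/-- `Ω` has a Lipschitz boundary: near every boundary point `x₀` there are a direction `ν` and a
Lipschitz function `g` of the component of `x` orthogonal to `ν` such that `Ω` coincides near `x₀`
with the region strictly above the graph of `g` (in the direction `ν`). -/
def HasLipschitzBoundary {N : ℕ} (Ω : Set (Rn N)) : Prop :=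
  ∀ x₀ ∈ frontier Ω, ∃ (ν : Rn N) (g : Rn N → ℝ) (K : NNReal), ‖ν‖ = 1 ∧ LipschitzWith K g ∧
    ∀ᶠ x in 𝓝 x₀, (x ∈ Ω ↔ g (x - (inner ℝ ν x : ℝ) • ν) < (inner ℝ ν x : ℝ))

/-- A bounded domain (nonempty connected open set) of `ℝ^N` with a Lipschitz boundary. -/
structure LipDomain (N : ℕ) where
  carrier : Set (Rn N)
  isOpen : IsOpen carrier
  isConnected : IsConnected carrier
  isBounded : Bornology.IsBounded carrier
  lipschitz : HasLipschitzBoundary carrier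

/-- Lebesgue measure on `Ω`. -/
abbrev LipDomain.vol {N : ℕ} (Ω : LipDomain N) : Measure (Rn N) := volume.restrict Ω.carrier

/-- `C₊(closure Ω)`: continuous functions on the closure of `Ω` with values `> 1` there.
(The values of `toFun` outside the closure of `Ω` play no role.) -/
structure CPlus {N : ℕ} (Ω : LipDomain N) where
  toFun : Rn N → ℝ
  continuousOn : ContinuousOn toFun (closure Ω.carrier)
  one_lt : ∀ x ∈ closure Ω.carrier, 1 < toFun x

instance {N : ℕ} {Ω : LipDomain N} : CoeFun (CPlus Ω) (fun _ => Rn N → ℝ) := ⟨CPlus.toFun⟩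

variable {N : ℕ} {Ω : LipDomain N}

/-- `h⁺`, the maximum of `h` on the closure of `Ω`. -/
def CPlus.upper (h : CPlus Ω) : ℝ := sSup (h '' closure Ω.carrier)

/-- `h⁻`, the minimum of `h` on the closure of `Ω`. -/
def CPlus.lower (h : CPlus Ω) : ℝ := sInf (h '' closure Ω.carrier)

/-- The conjugate exponent `p'`, `1 / p(x) + 1 / p'(x) = 1`. -/
def CPlus.conj (p : CPlus Ω) : CPlus Ω where
  toFun x := p x / (p x - 1)
  continuousOn := p.continuousOn.div (p.continuousOn.sub continuousOn_const)
    (fun x hx => by have := p.one_lt x hx; linarith)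
  one_lt x hx := by
    have := p.one_lt x hx
    rw [lt_div_iff₀ (by linarith)]
    linarith

/-- Log-Hölder continuity of the exponent. -/
def CPlus.LogHolder (p : CPlus Ω) : Prop :=
  ∃ α : ℝ, 0 < α ∧ ∀ x ∈ Ω.carrier, ∀ y ∈ Ω.carrier, x ≠ y → ‖x - y‖ ≤ 1 / 2 →
    |p x - p y| ≤ α / (-Real.log ‖x - y‖)

theorem LipDomain.isCompact_closure (Ω : LipDomain N) : IsCompact (closure Ω.carrier) :=
  Ω.isBounded.isCompact_closure

theorem CPlus.le_upper (p : CPlus Ω) {x : Rn N} (hx : x ∈ closure Ω.carrier) : p x ≤ p.upper :=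
  le_csSup (Ω.isCompact_closure.image_of_continuousOn p.continuousOn).bddAbove ⟨x, hx, rfl⟩

theorem CPlus.lower_le (p : CPlus Ω) {x : Rn N} (hx : x ∈ closure Ω.carrier) : p.lower ≤ p x :=
  csInf_le (Ω.isCompact_closure.image_of_continuousOn p.continuousOn).bddBelow ⟨x, hx, rfl⟩

theorem CPlus.ae_bounds (p : CPlus Ω) : ∀ᵐ x ∂Ω.vol, 1 < p x ∧ p x ≤ p.upper := by
  refine (ae_restrict_mem Ω.isOpen.measurableSet).mono fun x hx => ?_
  exact ⟨p.one_lt x (subset_closure hx), p.le_upper (subset_closure hx)⟩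

theorem CPlus.aemeasurable (p : CPlus Ω) : AEMeasurable p Ω.vol :=
  (p.continuousOn.mono subset_closure).aemeasurable Ω.isOpen.measurableSet

/-! ## Variable exponent Lebesgue spaces -/

variable {F : Type*} [NormedAddCommGroup F]

/-- The modular `ρ_{p(x)}(u) = ∫_Ω |u(x)|^{p(x)} dx ∈ [0, ∞]`. -/
def modular (p : CPlus Ω) (u : Rn N → F) : ENNReal :=
  ∫⁻ x, ENNReal.ofReal (‖u x‖ ^ p x) ∂Ω.vol

theorem modular_congr (p : CPlus Ω) {u v : Rn N → F} (h : u =ᵐ[Ω.vol] v) :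
    modular p u = modular p v :=
  lintegral_congr_ae (h.mono fun x hx => by simp only [hx])

theorem modular_mono (p : CPlus Ω) {u v : Rn N → F} (h : ∀ᵐ x ∂Ω.vol, ‖u x‖ ≤ ‖v x‖) :
    modular p u ≤ modular p v := by
  refine lintegral_mono_ae ?_
  filter_upwards [h, p.ae_bounds] with x hx hp
  exact ENNReal.ofReal_le_ofReal (Real.rpow_le_rpow (norm_nonneg _) hx (by linarith))

theorem modular_aemeasurable (p : CPlus Ω) {u : Rn N → F} (hu : AEStronglyMeasurable u Ω.vol) :
    AEMeasurable (fun x => ENNReal.ofReal (‖u x‖ ^ p x)) Ω.vol :=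
  (hu.norm.aemeasurable.pow p.aemeasurable).ennreal_ofReal

theorem modular_zero (p : CPlus Ω) : modular p (fun _ => (0 : F)) = 0 := by
  unfold modular
  refine (lintegral_congr_ae ?_).trans lintegral_zero
  filter_upwards [p.ae_bounds] with x hp
  simp [Real.zero_rpow (by linarith : p x ≠ 0)]

variable [NormedSpace ℝ F]

theorem modular_convex (p : CPlus Ω) {u v : Rn N → F} (hu : AEStronglyMeasurable u Ω.vol)
    {a b : ℝ} (ha : 0 ≤ a) (hb : 0 ≤ b) (hab : a + b = 1) :
    modular p (fun x => a • u x + b • v x) ≤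
      ENNReal.ofReal a * modular p u + ENNReal.ofReal b * modular p v := by
  unfold modular
  rw [← lintegral_const_mul' _ _ ENNReal.ofReal_ne_top,
    ← lintegral_const_mul' _ _ ENNReal.ofReal_ne_top,
    ← lintegral_add_left' ((modular_aemeasurable p hu).const_mul _)]
  refine lintegral_mono_ae ?_
  filter_upwards [p.ae_bounds] with x hp
  rw [← ENNReal.ofReal_mul ha, ← ENNReal.ofReal_mul hb, ← ENNReal.ofReal_add
    (by positivity) (by positivity)]
  apply ENNReal.ofReal_le_ofReal
  have h1 : ‖a • u x + b • v x‖ ≤ a * ‖u x‖ + b * ‖v x‖ := by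
    refine (norm_add_le _ _).trans ?_
    rw [norm_smul, norm_smul, Real.norm_of_nonneg ha, Real.norm_of_nonneg hb]
  refine (Real.rpow_le_rpow (norm_nonneg _) h1 (by linarith)).trans ?_
  have := (convexOn_rpow hp.1.le).2 (norm_nonneg (u x)) (norm_nonneg (v x)) ha hb hab
  simpa using this

/-- Contraction: `ρ(c u) ≤ c ρ(u)` for `0 ≤ c ≤ 1`. -/
theorem modular_smul_le (p : CPlus Ω) {u : Rn N → F} (hu : AEStronglyMeasurable u Ω.vol)
    {c : ℝ} (h0 : 0 ≤ c) (h1 : c ≤ 1) :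
    modular p (fun x => c • u x) ≤ ENNReal.ofReal c * modular p u := by
  have := modular_convex p (v := fun _ => (0 : F)) hu h0 (sub_nonneg.2 h1) (by ring)
  simpa [modular_zero] using this

theorem modular_smul_lt_top (p : CPlus Ω) {u : Rn N → F} (c : ℝ) (h : modular p u < ⊤) :
    modular p (fun x => c • u x) < ⊤ := by
  have key : modular p (fun x => c • u x) ≤
      ENNReal.ofReal ((max 1 |c|) ^ p.upper) * modular p u := by
    unfold modular
    rw [← lintegral_const_mul' _ _ ENNReal.ofReal_ne_top]
    refine lintegral_mono_ae ?_
    filter_upwards [p.ae_bounds] with x hp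
    rw [← ENNReal.ofReal_mul (by positivity)]
    apply ENNReal.ofReal_le_ofReal
    rw [norm_smul, Real.mul_rpow (norm_nonneg _) (norm_nonneg _), Real.norm_eq_abs]
    gcongr
    calc |c| ^ p x ≤ (max 1 |c|) ^ p x := by
          apply Real.rpow_le_rpow (abs_nonneg _) (le_max_right _ _) (by linarith)
      _ ≤ (max 1 |c|) ^ p.upper := Real.rpow_le_rpow_of_exponent_le (le_max_left _ _) hp.2
  exact key.trans_lt (ENNReal.mul_lt_top ENNReal.ofReal_lt_top h)

variable (F) in
/-- The variable exponent Lebesgue space `L^{p(x)}(Ω; F)` of (classes of a.e. equal) measurable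
functions with finite modular, as a linear subspace of all measurable functions. -/
def lebesgueSubmodule (p : CPlus Ω) : Submodule ℝ (Rn N →ₘ[Ω.vol] F) where
  carrier := {u | modular p u < ⊤}
  zero_mem' := by
    have : modular p ((0 : Rn N →ₘ[Ω.vol] F) : Rn N → F) = 0 := by
      rw [modular_congr p AEEqFun.coeFn_zero]; exact modular_zero p
    simp [this]
  add_mem' := by
    intro u v hu hv
    simp only [mem_ofPred_eq] at hu hv ⊢
    rw [modular_congr p (v := fun x => (2 : ℝ) • (((1 / 2 : ℝ)) • u x + (1 / 2 : ℝ) • v x))]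
    · apply modular_smul_lt_top
      refine (modular_convex p u.aestronglyMeasurable (by norm_num) (by norm_num)
        (by norm_num)).trans_lt ?_
      exact ENNReal.add_lt_top.2 ⟨ENNReal.mul_lt_top ENNReal.ofReal_lt_top hu,
        ENNReal.mul_lt_top ENNReal.ofReal_lt_top hv⟩
    · filter_upwards [AEEqFun.coeFn_add u v] with x hx
      rw [hx, ← smul_add, smul_smul]; norm_num
  smul_mem' := by
    intro c u hu
    simp only [mem_ofPred_eq] at hu ⊢
    rw [modular_congr p (AEEqFun.coeFn_smul c u)]
    exact modular_smul_lt_top p c hu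

variable (F) in
/-- The variable exponent Lebesgue space `L^{p(x)}(Ω; F)`. -/
def Lebesgue (p : CPlus Ω) : Type _ := lebesgueSubmodule F p

instance (p : CPlus Ω) : AddCommGroup (Lebesgue F p) :=
  inferInstanceAs (AddCommGroup (lebesgueSubmodule F p))

instance (p : CPlus Ω) : Module ℝ (Lebesgue F p) :=
  inferInstanceAs (Module ℝ (lebesgueSubmodule F p))

/-- The underlying class of a.e. equal functions. -/
def Lebesgue.toAEEqFun {p : CPlus Ω} (u : Lebesgue F p) : Rn N →ₘ[Ω.vol] F :=
  (lebesgueSubmodule F p).subtype u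

instance (p : CPlus Ω) : CoeFun (Lebesgue F p) (fun _ => Rn N → F) := ⟨fun u => ⇑u.toAEEqFun⟩

theorem Lebesgue.modular_lt_top {p : CPlus Ω} (u : Lebesgue F p) : modular p u < ⊤ :=
  Subtype.property (p := fun w => w ∈ lebesgueSubmodule F p) u

theorem Lebesgue.ext {p : CPlus Ω} {u v : Lebesgue F p} (h : u =ᵐ[Ω.vol] v) : u = v :=
  Subtype.ext (AEEqFun.ext h)

theorem Lebesgue.coeFn_zero {p : CPlus Ω} : ⇑(0 : Lebesgue F p) =ᵐ[Ω.vol] fun _ => 0 :=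
  AEEqFun.coeFn_zero

/-- The Luxemburg norm `|u|_{p(x)} = inf {t > 0 : ρ_{p(x)}(u / t) ≤ 1}`. -/
instance (p : CPlus Ω) : Norm (Lebesgue F p) :=
  ⟨fun u => sInf {t : ℝ | 0 < t ∧ modular p (fun x => t⁻¹ • u x) ≤ 1}⟩

theorem Lebesgue.norm_def {p : CPlus Ω} (u : Lebesgue F p) :
    ‖u‖ = sInf {t : ℝ | 0 < t ∧ modular p (fun x => t⁻¹ • u x) ≤ 1} := rfl

theorem Lebesgue.coeFn_add {p : CPlus Ω} (u v : Lebesgue F p) :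
    ⇑(u + v) =ᵐ[Ω.vol] fun x => u x + v x := AEEqFun.coeFn_add u.toAEEqFun v.toAEEqFun

theorem Lebesgue.coeFn_smul {p : CPlus Ω} (c : ℝ) (u : Lebesgue F p) :
    ⇑(c • u) =ᵐ[Ω.vol] fun x => c • u x := AEEqFun.coeFn_smul c u.toAEEqFun

theorem Lebesgue.aestronglyMeasurable {p : CPlus Ω} (u : Lebesgue F p) :
    AEStronglyMeasurable u Ω.vol := AEEqFun.aestronglyMeasurable u.toAEEqFun

theorem Lebesgue.norm_bddBelow {p : CPlus Ω} (u : Lebesgue F p) :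
    BddBelow {t : ℝ | 0 < t ∧ modular p (fun x => t⁻¹ • u x) ≤ 1} := ⟨0, fun _ h => h.1.le⟩

theorem Lebesgue.norm_set_nonempty {p : CPlus Ω} (u : Lebesgue F p) :
    {t : ℝ | 0 < t ∧ modular p (fun x => t⁻¹ • u x) ≤ 1}.Nonempty := by
  have hu := u.modular_lt_top
  set m := (modular p u).toReal
  have hm : 0 ≤ m := ENNReal.toReal_nonneg
  refine ⟨m + 1, by positivity, ?_⟩
  refine (modular_smul_le p u.aestronglyMeasurable (by positivity)
    (inv_le_one_of_one_le₀ (by linarith))).trans ?_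
  have hm' : modular p u = ENNReal.ofReal m := (ENNReal.ofReal_toReal hu.ne).symm
  rw [hm', ← ENNReal.ofReal_mul (by positivity), ENNReal.ofReal_le_one,
    inv_mul_le_iff₀ (by positivity)]
  linarith

theorem Lebesgue.modular_le_one {p : CPlus Ω} (u : Lebesgue F p) {t : ℝ} (ht : ‖u‖ < t) :
    0 < t ∧ modular p (fun x => t⁻¹ • u x) ≤ 1 := by
  obtain ⟨s, ⟨hs, hs1⟩, hst⟩ := exists_lt_of_csInf_lt u.norm_set_nonempty ht
  refine ⟨hs.trans hst, (modular_mono p (Filter.Eventually.of_forall fun x => ?_)).trans hs1⟩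
  rw [norm_smul, norm_smul, norm_inv, norm_inv, Real.norm_of_nonneg hs.le,
    Real.norm_of_nonneg (hs.trans hst).le]
  gcongr

theorem Lebesgue.norm_le_of_modular {p : CPlus Ω} (u : Lebesgue F p) {t : ℝ} (ht : 0 < t)
    (h : modular p (fun x => t⁻¹ • u x) ≤ 1) : ‖u‖ ≤ t :=
  csInf_le u.norm_bddBelow ⟨ht, h⟩

theorem Lebesgue.norm_nonneg' {p : CPlus Ω} (u : Lebesgue F p) : 0 ≤ ‖u‖ :=
  le_csInf u.norm_set_nonempty fun _ h => h.1.le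

theorem Lebesgue.norm_smul_le' {p : CPlus Ω} (c : ℝ) (u : Lebesgue F p) :
    ‖c • u‖ ≤ |c| * ‖u‖ := by
  rcases eq_or_ne c 0 with rfl | hc
  · simp only [abs_zero, zero_mul]
    refine le_of_forall_gt_imp_ge_of_dense fun t ht => ?_
    refine Lebesgue.norm_le_of_modular _ ht ?_
    rw [modular_congr p (v := fun _ => (0 : F)), modular_zero]
    · exact zero_le_one
    · filter_upwards [Lebesgue.coeFn_smul (0 : ℝ) u] with x hx
      rw [hx, zero_smul, smul_zero]
  · have hc' : 0 < |c| := abs_pos.2 hc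
    rw [← div_le_iff₀' hc']
    refine le_of_forall_gt_imp_ge_of_dense fun t ht => ?_
    obtain ⟨ht0, h1⟩ := u.modular_le_one ht
    rw [div_le_iff₀' hc']
    refine Lebesgue.norm_le_of_modular _ (by positivity) (le_trans ?_ h1)
    refine modular_mono p ?_
    filter_upwards [Lebesgue.coeFn_smul c u] with x hx
    rw [hx, smul_smul, norm_smul, norm_smul, norm_mul, norm_inv, norm_inv, norm_mul,
      Real.norm_eq_abs, Real.norm_eq_abs, Real.norm_eq_abs, abs_abs]
    apply le_of_eq
    field_simp

theorem Lebesgue.core (p : CPlus Ω) : NormedSpace.Core ℝ (Lebesgue F p) where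
  norm_nonneg := Lebesgue.norm_nonneg'
  norm_smul c u := by
    rw [Real.norm_eq_abs]
    refine le_antisymm (Lebesgue.norm_smul_le' c u) ?_
    rcases eq_or_ne c 0 with rfl | hc
    · simpa using Lebesgue.norm_nonneg' _
    · have h := Lebesgue.norm_smul_le' c⁻¹ (c • u)
      rw [smul_smul, inv_mul_cancel₀ hc, one_smul, abs_inv] at h
      rwa [← le_inv_mul_iff₀ (abs_pos.2 hc)]
  norm_triangle u v := by
    refine le_of_forall_pos_le_add fun ε hε => ?_
    obtain ⟨ht, h1⟩ := u.modular_le_one (t := ‖u‖ + ε / 2) (by linarith)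
    obtain ⟨hs, h2⟩ := v.modular_le_one (t := ‖v‖ + ε / 2) (by linarith)
    set t := ‖u‖ + ε / 2
    set s := ‖v‖ + ε / 2
    have hts : ‖u‖ + ‖v‖ + ε = t + s := by simp only [t, s]; ring
    rw [hts]
    refine Lebesgue.norm_le_of_modular _ (by positivity) ?_
    have hc := modular_convex p (u := fun x => t⁻¹ • u x) (v := fun x => s⁻¹ • v x)
      (u.aestronglyMeasurable.const_smul _) (a := t / (t + s)) (b := s / (t + s))
      (by positivity) (by positivity) (by field_simp)
    rw [modular_congr p (v := fun x => (t / (t + s)) • t⁻¹ • u x + (s / (t + s)) • s⁻¹ • v x)]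
    · refine hc.trans ?_
      calc _ ≤ ENNReal.ofReal (t / (t + s)) * 1 + ENNReal.ofReal (s / (t + s)) * 1 := by gcongr
        _ = 1 := by
          rw [mul_one, mul_one, ← ENNReal.ofReal_add (by positivity) (by positivity),
            ← add_div, div_self (by positivity), ENNReal.ofReal_one]
    · filter_upwards [Lebesgue.coeFn_add u v] with x hx
      rw [hx, smul_add, smul_smul, smul_smul]
      congr 2 <;> field_simp
  norm_eq_zero_iff u := by
    constructor
    · intro h
      have hle : ∀ t : ℝ, 0 < t → t ≤ 1 → modular p u ≤ ENNReal.ofReal t := by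
        intro t ht ht1
        obtain ⟨-, h1⟩ := u.modular_le_one (t := t) (by rw [h]; exact ht)
        have := modular_smul_le p (u := fun x => t⁻¹ • u x)
          (u.aestronglyMeasurable.const_smul _) ht.le ht1
        simp only [smul_smul, mul_inv_cancel₀ ht.ne', one_smul] at this
        exact this.trans (mul_le_of_le_one_right' h1)
      have h0 : modular p u = 0 := by
        by_contra hne
        have hlt : modular p u ≠ ⊤ := u.modular_lt_top.ne
        have hpos := ENNReal.toReal_pos hne hlt
        have := hle (min 1 ((modular p u).toReal / 2)) (by positivity) (min_le_left _ _)
        have := (ENNReal.toReal_le_of_le_ofReal (by positivity) this).trans (min_le_right _ _)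
        linarith
      unfold modular at h0
      rw [lintegral_eq_zero_iff' (modular_aemeasurable p u.aestronglyMeasurable)] at h0
      refine Lebesgue.ext (Filter.EventuallyEq.trans ?_ Lebesgue.coeFn_zero.symm)
      filter_upwards [h0, p.ae_bounds] with x hx hp
      simp only [Pi.zero_apply, ENNReal.ofReal_eq_zero] at hx
      have h3 : ‖u x‖ ^ p x = 0 := le_antisymm hx (by positivity)
      have := (Real.rpow_eq_zero (norm_nonneg _) (by linarith)).1 h3
      exact norm_eq_zero.1 this
    · rintro rfl
      have := Lebesgue.norm_smul_le' (0 : ℝ) (0 : Lebesgue F p)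
      rw [zero_smul, abs_zero, zero_mul] at this
      exact le_antisymm this (Lebesgue.norm_nonneg' _)

instance (p : CPlus Ω) : NormedAddCommGroup (Lebesgue F p) :=
  NormedAddCommGroup.ofCore (Lebesgue.core p)

instance (p : CPlus Ω) : NormedSpace ℝ (Lebesgue F p) :=
  NormedSpace.ofCore (Lebesgue.core p)

/-! ## Variable exponent Sobolev spaces -/

/-- `g` is the weak gradient of `u` on the open set `U`:
`∫_U u ∂ᵢφ dx = - ∫_U gᵢ φ dx` for all `φ ∈ C_c^∞(U)` and all `i`. -/
structure IsWeakGradient (U : Set (Rn N)) (u : Rn N → ℝ) (g : Rn N → Rn N) : Prop where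
  locInt : LocallyIntegrableOn u U
  locInt_grad : LocallyIntegrableOn g U
  integral_eq : ∀ φ : Rn N → ℝ, ContDiff ℝ ∞ φ → HasCompactSupport φ → tsupport φ ⊆ U →
    ∀ i : Fin N, ∫ x in U, u x * fderiv ℝ φ x (EuclideanSpace.single i 1) =
      - ∫ x in U, g x i * φ x

theorem integrable_mul_test {U : Set (Rn N)} {w ψ : Rn N → ℝ} (hw : LocallyIntegrableOn w U)
    (hψ : Continuous ψ) (hc : HasCompactSupport ψ) (hs : tsupport ψ ⊆ U) :
    IntegrableOn (fun x => w x * ψ x) U := by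
  have h1 : IntegrableOn (fun x => w x * ψ x) (tsupport ψ) :=
    (hw.integrableOn_compact_subset hs hc).mul_continuousOn hψ.continuousOn hc
  have h2 : Integrable (fun x => w x * ψ x) := by
    refine (integrableOn_iff_integrable_of_support_subset ?_).1 h1
    intro x hx
    apply subset_tsupport
    simp only [Function.mem_support] at hx ⊢
    exact right_ne_zero_of_mul hx
  exact h2.integrableOn

theorem locInt_coord {U : Set (Rn N)} {g : Rn N → Rn N} (hg : LocallyIntegrableOn g U)
    (i : Fin N) : LocallyIntegrableOn (fun x => g x i) U := by
  intro x hx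
  obtain ⟨s, hs, h⟩ := hg x hx
  exact ⟨s, hs, (EuclideanSpace.proj (𝕜 := ℝ) i).integrable_comp h⟩

theorem integrable_mul_dtest {U : Set (Rn N)} {w φ : Rn N → ℝ} (hw : LocallyIntegrableOn w U)
    (hφ : ContDiff ℝ ∞ φ) (hc : HasCompactSupport φ) (hs : tsupport φ ⊆ U) (v : Rn N) :
    IntegrableOn (fun x => w x * fderiv ℝ φ x v) U := by
  have hsub : tsupport (fun x => fderiv ℝ φ x v) ⊆ tsupport φ := by
    refine (closure_mono ?_).trans (tsupport_fderiv_subset ℝ (f := φ))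
    intro x hx
    simp only [Function.mem_support] at hx ⊢
    intro h
    simp [h] at hx
  exact integrable_mul_test hw ((hφ.continuous_fderiv (by simp)).clm_apply continuous_const)
    (hc.of_isClosed_subset (isClosed_tsupport _) hsub) (hsub.trans hs)

theorem IsWeakGradient.lin {U : Set (Rn N)} {u v : Rn N → ℝ} {g k : Rn N → Rn N}
    (hu : IsWeakGradient U u g) (hv : IsWeakGradient U v k) (a b : ℝ) :
    IsWeakGradient U (fun x => a * u x + b * v x) (fun x => a • g x + b • k x) where
  locInt := (hu.locInt.smul a).add (hv.locInt.smul b)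
  locInt_grad := (hu.locInt_grad.smul a).add (hv.locInt_grad.smul b)
  integral_eq φ h1 h2 h3 i := by
    have e1 := integrable_mul_dtest hu.locInt h1 h2 h3 (EuclideanSpace.single i 1)
    have e2 := integrable_mul_dtest hv.locInt h1 h2 h3 (EuclideanSpace.single i 1)
    have e3 := integrable_mul_test (locInt_coord hu.locInt_grad i) h1.continuous h2 h3
    have e4 := integrable_mul_test (locInt_coord hv.locInt_grad i) h1.continuous h2 h3
    have l1 := hu.integral_eq φ h1 h2 h3 i
    have l2 := hv.integral_eq φ h1 h2 h3 i
    simp only [add_mul, PiLp.add_apply, PiLp.smul_apply, smul_eq_mul, mul_assoc]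
    rw [integral_add (e1.const_mul a) (e2.const_mul b),
      integral_add (e3.const_mul a) (e4.const_mul b), integral_const_mul, integral_const_mul,
      integral_const_mul, integral_const_mul, l1, l2]
    ring

theorem IsWeakGradient.congr {U : Set (Rn N)} {u v : Rn N → ℝ} {g k : Rn N → Rn N}
    (hu : IsWeakGradient U u g) (h1 : u =ᵐ[volume.restrict U] v)
    (h2 : g =ᵐ[volume.restrict U] k) (hU : IsOpen U) : IsWeakGradient U v k where
  locInt := by
    rw [locallyIntegrableOn_iff (Or.inr hU.isLocallyClosed |>.elim id id)]
    intro K hK hKc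
    exact (hu.locInt.integrableOn_compact_subset hK hKc).congr
      (ae_restrict_of_ae_restrict_of_subset hK h1)
  locInt_grad := by
    rw [locallyIntegrableOn_iff (Or.inr hU.isLocallyClosed |>.elim id id)]
    intro K hK hKc
    exact (hu.locInt_grad.integrableOn_compact_subset hK hKc).congr
      (ae_restrict_of_ae_restrict_of_subset hK h2)
  integral_eq φ a b c i := by
    rw [integral_congr_ae (g := fun x => u x * fderiv ℝ φ x (EuclideanSpace.single i 1))
      (h1.mono fun x hx => by simp only [hx]),
      integral_congr_ae (f := fun x => k x i * φ x) (g := fun x => g x i * φ x)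
      (h2.mono fun x hx => by simp only [hx])]
    exact hu.integral_eq φ a b c i

/-- Weak gradients are unique up to a.e. equality. -/
theorem IsWeakGradient.unique {U : Set (Rn N)} (hU : IsOpen U) {u : Rn N → ℝ}
    {g k : Rn N → Rn N} (hg : IsWeakGradient U u g) (hk : IsWeakGradient U u k) :
    g =ᵐ[volume.restrict U] k := by
  have key : ∀ i : Fin N, ∀ᵐ x ∂volume.restrict U, g x i = k x i := by
    intro i
    have hl : LocallyIntegrableOn (fun x => g x i - k x i) U :=
      (locInt_coord hg.locInt_grad i).sub (locInt_coord hk.locInt_grad i)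
    have := hU.ae_eq_zero_of_integral_contDiff_smul_eq_zero hl (fun φ h1 h2 h3 => by
      have e3 := integrable_mul_test (locInt_coord hg.locInt_grad i) h1.continuous h2 h3
      have e4 := integrable_mul_test (locInt_coord hk.locInt_grad i) h1.continuous h2 h3
      have l1 := hg.integral_eq φ h1 h2 h3 i
      have l2 := hk.integral_eq φ h1 h2 h3 i
      rw [← setIntegral_eq_integral_of_forall_compl_eq_zero (s := U)]
      · have : ∀ x, φ x • (g x i - k x i) = g x i * φ x - k x i * φ x := by
          intro x; rw [smul_eq_mul]; ring
        simp only [this]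
        rw [integral_sub e3 e4]
        linarith
      · intro x hx
        rw [image_eq_zero_of_notMem_tsupport (fun h => hx (h3 h)), zero_smul])
    rw [ae_restrict_iff' hU.measurableSet]
    filter_upwards [this] with x hx hxU
    exact sub_eq_zero.1 (hx hxU)
  filter_upwards [ae_all_iff.2 key] with x hx
  ext i
  exact hx i

/-- The variable exponent Sobolev space `W^{1,p(x)}(Ω)` of all `u ∈ L^{p(x)}(Ω)` that have a weak
gradient `∇u` with `|∇u| ∈ L^{p(x)}(Ω)`, as a linear subspace of `L^{p(x)}(Ω)`. -/
def sobolevSubmodule (p : CPlus Ω) : Submodule ℝ (Lebesgue ℝ p) where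
  carrier := {u | ∃ g : Lebesgue (Rn N) p, IsWeakGradient Ω.carrier u g}
  zero_mem' := by
    refine ⟨0, IsWeakGradient.congr (u := fun _ => 0) (g := fun _ => 0)
      ⟨(integrable_zero _ _ _).locallyIntegrable.locallyIntegrableOn _,
       (integrable_zero _ _ _).locallyIntegrable.locallyIntegrableOn _, by simp⟩ ?_ ?_ Ω.isOpen⟩
    · exact Lebesgue.coeFn_zero.symm
    · exact Lebesgue.coeFn_zero.symm
  add_mem' := by
    rintro u v ⟨g, hg⟩ ⟨k, hk⟩
    refine ⟨g + k, (hg.lin hk 1 1).congr ?_ ?_ Ω.isOpen⟩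
    · filter_upwards [Lebesgue.coeFn_add u v] with x hx
      simp [hx]
    · filter_upwards [Lebesgue.coeFn_add g k] with x hx
      simp [hx]
  smul_mem' := by
    rintro c u ⟨g, hg⟩
    refine ⟨c • g, (hg.lin hg c 0).congr ?_ ?_ Ω.isOpen⟩
    · filter_upwards [Lebesgue.coeFn_smul c u] with x hx
      simp [hx]
    · filter_upwards [Lebesgue.coeFn_smul c g] with x hx
      simp [hx]

/-- The variable exponent Sobolev space `W^{1,p(x)}(Ω)`. -/
def Sobolev (p : CPlus Ω) : Type := sobolevSubmodule p

instance (p : CPlus Ω) : AddCommGroup (Sobolev p) :=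
  inferInstanceAs (AddCommGroup (sobolevSubmodule p))

instance (p : CPlus Ω) : Module ℝ (Sobolev p) :=
  inferInstanceAs (Module ℝ (sobolevSubmodule p))

/-- The embedding `W^{1,p(x)}(Ω) → L^{p(x)}(Ω)`. -/
def Sobolev.toLebesgue (p : CPlus Ω) : Sobolev p →ₗ[ℝ] Lebesgue ℝ p :=
  (sobolevSubmodule p).subtype

instance (p : CPlus Ω) : CoeFun (Sobolev p) (fun _ => Rn N → ℝ) :=
  ⟨fun u => ⇑(Sobolev.toLebesgue p u)⟩

theorem Sobolev.exists_grad {p : CPlus Ω} (u : Sobolev p) :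
    ∃ g : Lebesgue (Rn N) p, IsWeakGradient Ω.carrier u g :=
  Subtype.property (p := fun w => w ∈ sobolevSubmodule p) u

/-- The weak gradient `∇u ∈ L^{p(x)}(Ω; ℝ^N)` of `u ∈ W^{1,p(x)}(Ω)`. -/
def Sobolev.grad {p : CPlus Ω} (u : Sobolev p) : Lebesgue (Rn N) p := u.exists_grad.choose

theorem Sobolev.isWeakGradient {p : CPlus Ω} (u : Sobolev p) :
    IsWeakGradient Ω.carrier u u.grad := u.exists_grad.choose_spec

theorem Sobolev.grad_eq {p : CPlus Ω} (u : Sobolev p) {g : Lebesgue (Rn N) p}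
    (h : IsWeakGradient Ω.carrier u g) : u.grad = g :=
  Lebesgue.ext (u.isWeakGradient.unique Ω.isOpen h)

theorem Sobolev.grad_add {p : CPlus Ω} (u v : Sobolev p) :
    (u + v).grad = u.grad + v.grad := by
  refine Sobolev.grad_eq _ ((u.isWeakGradient.lin v.isWeakGradient 1 1).congr ?_ ?_ Ω.isOpen)
  · filter_upwards [Lebesgue.coeFn_add (toLebesgue p u) (toLebesgue p v)] with x hx
    rw [map_add, hx, one_mul, one_mul]
  · filter_upwards [Lebesgue.coeFn_add u.grad v.grad] with x hx
    simp [hx]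

theorem Sobolev.grad_smul {p : CPlus Ω} (c : ℝ) (u : Sobolev p) :
    (c • u).grad = c • u.grad := by
  refine Sobolev.grad_eq _ ((u.isWeakGradient.lin u.isWeakGradient c 0).congr ?_ ?_ Ω.isOpen)
  · filter_upwards [Lebesgue.coeFn_smul c (toLebesgue p u)] with x hx
    rw [map_smul, hx, zero_mul, add_zero, smul_eq_mul]
  · filter_upwards [Lebesgue.coeFn_smul c u.grad] with x hx
    simp [hx]

/-- The norm `‖u‖ = |u|_{p(x)} + |∇u|_{p(x)}`. -/
instance (p : CPlus Ω) : Norm (Sobolev p) := ⟨fun u => ‖Sobolev.toLebesgue p u‖ + ‖u.grad‖⟩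

theorem Sobolev.norm_def {p : CPlus Ω} (u : Sobolev p) :
    ‖u‖ = ‖Sobolev.toLebesgue p u‖ + ‖u.grad‖ := rfl

theorem Sobolev.core (p : CPlus Ω) : NormedSpace.Core ℝ (Sobolev p) where
  norm_nonneg u := by rw [Sobolev.norm_def]; positivity
  norm_smul c u := by
    rw [Sobolev.norm_def, Sobolev.norm_def, Sobolev.grad_smul, map_smul, norm_smul, norm_smul]
    ring
  norm_triangle u v := by
    rw [Sobolev.norm_def, Sobolev.norm_def, Sobolev.norm_def, Sobolev.grad_add, map_add]
    linarith [norm_add_le (Sobolev.toLebesgue p u) (Sobolev.toLebesgue p v),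
      norm_add_le u.grad v.grad]
  norm_eq_zero_iff u := by
    constructor
    · intro h
      rw [Sobolev.norm_def] at h
      have h1 : ‖Sobolev.toLebesgue p u‖ = 0 :=
        le_antisymm (by linarith [norm_nonneg u.grad]) (norm_nonneg _)
      exact Subtype.ext (norm_eq_zero.1 h1)
    · rintro rfl
      have h := Sobolev.grad_smul (0 : ℝ) (0 : Sobolev p)
      rw [zero_smul, zero_smul] at h
      rw [Sobolev.norm_def, map_zero, h, norm_zero, norm_zero, add_zero]

instance (p : CPlus Ω) : NormedAddCommGroup (Sobolev p) :=
  NormedAddCommGroup.ofCore (Sobolev.core p)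

instance (p : CPlus Ω) : NormedSpace ℝ (Sobolev p) :=
  NormedSpace.ofCore (Sobolev.core p)

/-- `W^{-1,p'(x)}(Ω)`: the (normed) dual space of `W^{1,p(x)}(Ω)`. -/
abbrev DualSobolev (p : CPlus Ω) : Type := StrongDual ℝ (Sobolev p)

/-! ## The nonlinearity and compact operators -/

/-- The Carathéodory condition: `f(·, ζ, ξ)` is (Lebesgue) measurable on `Ω` for all `(ζ, ξ)`, and
`f(x, ·, ·)` is continuous for a.e. `x ∈ Ω`. -/
def IsCaratheodory (Ω : LipDomain N) (f : Rn N → ℝ → Rn N → ℝ) : Prop :=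
  (∀ (ζ : ℝ) (ξ : Rn N), AEMeasurable (fun x => f x ζ ξ) Ω.vol) ∧
    ∀ᵐ x ∂Ω.vol, Continuous (fun z : ℝ × Rn N => f x z.1 z.2)

/-- The growth condition: there are `β > 0`, `γ ∈ L^{p'(x)}(Ω)` and `q ∈ C₊(closure Ω)` with
`2 ≤ q⁻ ≤ q⁺ < p⁻` such that `|f(x,ζ,ξ)| ≤ β (γ(x) + |ζ|^{q(x)-1} + |ξ|^{q(x)-1})` for a.e.
`x ∈ Ω` and all `(ζ, ξ)`. -/
def HasGrowth (p : CPlus Ω) (f : Rn N → ℝ → Rn N → ℝ) : Prop :=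
  ∃ (β : ℝ) (γ : Lebesgue ℝ p.conj) (q : CPlus Ω), 0 < β ∧ 2 ≤ q.lower ∧ q.upper < p.lower ∧
    ∀ᵐ x ∂Ω.vol, ∀ (ζ : ℝ) (ξ : Rn N),
      |f x ζ ξ| ≤ β * (γ x + |ζ| ^ (q x - 1) + ‖ξ‖ ^ (q x - 1))

/-- A (possibly nonlinear) operator between normed spaces is compact if it is continuous and maps
bounded sets to relatively compact sets. -/
def IsCompactMap {X Y : Type*} [NormedAddCommGroup X] [NormedAddCommGroup Y] (T : X → Y) : Prop :=
  Continuous T ∧ ∀ B : Set X, Bornology.IsBounded B → IsCompact (closure (T '' B))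

end VarExp

end

noncomputable section

namespace VarExp

open Filter

/-! ### Modulars, the Luxemburg norm and duality in variable exponent Lebesgue spaces. -/

section LebesgueTools

variable {N : ℕ} {Ω : LipDomain N} {F : Type*} [NormedAddCommGroup F] [NormedSpace ℝ F]
  {G : Type*} [NormedAddCommGroup G] [NormedSpace ℝ G]

/-! The operator is `-lam` times a composition: the superposition operator `(u, ∇u) ↦ f(x, u, ∇u)`
into `L^{p'(x)}` (`nemytskii`), followed by `pairing`, the map from `L^{p'(x)}` to the dual of
`W^{1,p(x)}`. Continuity comes from the first factor: along an a.e. convergent subsequence, a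
generalised dominated convergence argument applies (`tendsto_nemytskii`).

Compactness uses both factors. A bounded set of `u` need not have relatively compact gradients, so
the functions `f(x, u, ∇u)` need not be relatively compact in `L^{p'(x)}`. However `q⁺ < p⁻` makes
`|f|^{p'}` sublinear in `|u|^p + |∇u|^p` (`HasGrowth.exists_growthBound`), hence equi-integrable on
bounded sets. Up to a uniformly small error in `L^{p'(x)}` they may then be replaced by functions
`g` with a common bound `M` that vanish off a common compact `K ⊆ Ω` (`exists_truncation`).

For such `g` a dual, interior form of Rellich's theorem holds (`totallyBounded_pairing_image`).
Replace `g` by a test function `h` with the same bound. Moving translations from `h` onto `φ` gives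
`|⟨η_r * h - h, φ⟩| ≤ r M ∫ |∇φ|`, so in the dual norm `h` is close to `η_r * h`, uniformly in `h`.
At fixed `r` the functions `η_r * h` are bounded and equi-Lipschitz, and the theorem of Arzelà and
Ascoli applies. Total boundedness then passes back through the approximations by
`totallyBounded_of_approx`. -/

instance LipDomain.isFiniteMeasure_vol (Ω : LipDomain N) : IsFiniteMeasure Ω.vol :=
  ⟨by simpa using Ω.isBounded.measure_lt_top⟩

/-! ### Modular and norm -/

theorem rpow_le_max_rpow (p : CPlus Ω) {x : Rn N} (hp : 1 < p x ∧ p x ≤ p.upper) {c : ℝ}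
    (hc : 0 ≤ c) : c ^ p x ≤ max 1 c ^ p.upper :=
  (Real.rpow_le_rpow hc (le_max_right _ _) (by linarith)).trans
    (Real.rpow_le_rpow_of_exponent_le (le_max_left _ _) hp.2)

/-- Since `p` is bounded, `|c|^{p(x)}` is dominated by a constant that leaves the integral. This
makes smallness of the modular and of the norm equivalent, with quantifiers uniform over the space.
-/
theorem modular_smul_le_max (p : CPlus Ω) {u : Rn N → F} (c : ℝ) :
    modular p (fun x => c • u x) ≤ ENNReal.ofReal (max 1 |c| ^ p.upper) * modular p u := by
  unfold modular
  rw [← lintegral_const_mul' _ _ ENNReal.ofReal_ne_top]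
  refine lintegral_mono_ae ?_
  filter_upwards [p.ae_bounds] with x hp
  rw [← ENNReal.ofReal_mul (by positivity)]
  apply ENNReal.ofReal_le_ofReal
  rw [norm_smul, Real.mul_rpow (norm_nonneg _) (norm_nonneg _), Real.norm_eq_abs]
  gcongr
  exact rpow_le_max_rpow p hp (abs_nonneg c)

theorem exists_norm_le_of_modular_le (p : CPlus Ω) {ε : ℝ} (hε : 0 < ε) :
    ∃ δ : ℝ, 0 < δ ∧ ∀ w : Lebesgue F p, modular p w ≤ ENNReal.ofReal δ → ‖w‖ ≤ ε := by
  have hpos : 0 < max 1 |ε⁻¹| ^ p.upper := by positivity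
  refine ⟨(max 1 |ε⁻¹| ^ p.upper)⁻¹, inv_pos.2 hpos, fun w hw => ?_⟩
  refine w.norm_le_of_modular hε ((modular_smul_le_max p _).trans ?_)
  calc _ ≤ ENNReal.ofReal (max 1 |ε⁻¹| ^ p.upper) *
        ENNReal.ofReal ((max 1 |ε⁻¹| ^ p.upper)⁻¹) := by gcongr
    _ = 1 := by rw [← ENNReal.ofReal_mul hpos.le, mul_inv_cancel₀ hpos.ne', ENNReal.ofReal_one]

theorem tendsto_norm_of_tendsto_modular {p : CPlus Ω} {ι : Type*} {l : Filter ι}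
    {w : ι → Lebesgue F p} (h : Tendsto (fun i => modular p (w i)) l (𝓝 0)) :
    Tendsto (fun i => ‖w i‖) l (𝓝 0) := by
  rw [Metric.tendsto_nhds]
  intro ε hε
  obtain ⟨δ, hδ, H⟩ := exists_norm_le_of_modular_le (F := F) p (half_pos hε)
  filter_upwards [h.eventually_lt_const (ENNReal.ofReal_pos.2 hδ)] with i hi
  have := H (w i) hi.le
  rw [dist_zero_right, norm_norm]
  linarith

theorem Lebesgue.modular_le_of_norm_lt {p : CPlus Ω} (u : Lebesgue F p) {t : ℝ} (ht : ‖u‖ < t) :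
    modular p u ≤ ENNReal.ofReal (max 1 t ^ p.upper) := by
  obtain ⟨h0, h1⟩ := u.modular_le_one ht
  have h := modular_smul_le_max p (u := fun x => t⁻¹ • u x) t
  simp only [smul_smul, mul_inv_cancel₀ h0.ne', one_smul, abs_of_pos h0] at h
  exact h.trans (mul_le_of_le_one_right' h1)

theorem tendsto_modular_of_tendsto_norm {p : CPlus Ω} {ι : Type*} {l : Filter ι}
    {w : ι → Lebesgue F p} (h : Tendsto (fun i => ‖w i‖) l (𝓝 0)) :
    Tendsto (fun i => modular p (w i)) l (𝓝 0) := by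
  have key : ∀ t : ℝ, 0 < t → t ≤ 1 → ∀ᶠ i in l, modular p (w i) ≤ ENNReal.ofReal t := by
    intro t h0 h1
    filter_upwards [h.eventually_lt_const h0] with i hi
    have h2 := ((w i).modular_le_one hi).2
    have h3 := modular_smul_le p (u := fun x => t⁻¹ • w i x)
      ((w i).aestronglyMeasurable.const_smul _) h0.le h1
    simp only [smul_smul, mul_inv_cancel₀ h0.ne', one_smul] at h3
    exact h3.trans (mul_le_of_le_one_right' h2)
  rw [ENNReal.tendsto_nhds_zero]
  intro ε hε
  obtain ⟨t, ht0, ht⟩ : ∃ t : ℝ, 0 < t ∧ ENNReal.ofReal t ≤ ε := by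
    obtain ⟨r, h0, hr⟩ := ENNReal.lt_iff_exists_nnreal_btwn.1 hε
    exact ⟨r, by simpa using h0, by simpa using hr.le⟩
  filter_upwards [key (min t 1) (by positivity) (min_le_right _ _)] with i hi
  exact hi.trans ((ENNReal.ofReal_le_ofReal (min_le_left _ _)).trans ht)

/-! ### Elements given by functions -/

/-- The element of `L^{p(x)}` given by a measurable function with finite modular. -/
def Lebesgue.mk {p : CPlus Ω} (u : Rn N → F) (hu : AEStronglyMeasurable u Ω.vol)
    (h : modular p u < ⊤) : Lebesgue F p :=
  ⟨AEEqFun.mk u hu, by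
    change modular p (AEEqFun.mk u hu) < ⊤
    rwa [modular_congr p (AEEqFun.coeFn_mk u hu)]⟩

theorem Lebesgue.coeFn_mk {p : CPlus Ω} (u : Rn N → F) (hu : AEStronglyMeasurable u Ω.vol)
    (h : modular p u < ⊤) : ⇑(Lebesgue.mk u hu h) =ᵐ[Ω.vol] u := AEEqFun.coeFn_mk u hu

theorem Lebesgue.coeFn_sub {p : CPlus Ω} (u v : Lebesgue F p) :
    ⇑(u - v) =ᵐ[Ω.vol] fun x => u x - v x := AEEqFun.coeFn_sub u.toAEEqFun v.toAEEqFun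

theorem modular_le_of_bound {E : Type*} [NormedAddCommGroup E] (p : CPlus Ω)
    {u : Rn N → E} {M : ℝ}
    (h : ∀ᵐ x ∂Ω.vol, ‖u x‖ ≤ M) :
    modular p u ≤ ENNReal.ofReal (max 1 M ^ p.upper) * Ω.vol univ := by
  unfold modular
  rw [← lintegral_const]
  refine lintegral_mono_ae ?_
  filter_upwards [h, p.ae_bounds] with x hx hp
  apply ENNReal.ofReal_le_ofReal
  refine (Real.rpow_le_rpow (norm_nonneg _) hx (by linarith)).trans ?_
  exact rpow_le_max_rpow p hp ((norm_nonneg _).trans hx)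

theorem modular_lt_top_of_bound {E : Type*} [NormedAddCommGroup E] (p : CPlus Ω)
    {u : Rn N → E} {M : ℝ}
    (h : ∀ᵐ x ∂Ω.vol, ‖u x‖ ≤ M) : modular p u < ⊤ :=
  (modular_le_of_bound p h).trans_lt
    (ENNReal.mul_lt_top ENNReal.ofReal_lt_top (measure_lt_top _ _))

/-- For `t > M * C` the quotient `|u| / t` is at most `C⁻¹ ≤ 1`. Raising to a power above 1 keeps it
below `C⁻¹`, and `C` is at least the volume, so the modular is at most 1. -/
theorem Lebesgue.norm_le_of_bound {p : CPlus Ω} (u : Lebesgue F p) {M : ℝ} (hM : 0 ≤ M)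
    (h : ∀ᵐ x ∂Ω.vol, ‖u x‖ ≤ M) : ‖u‖ ≤ M * max 1 (Ω.vol univ).toReal := by
  set C := max 1 (Ω.vol univ).toReal with hC
  have hC1 : 1 ≤ C := le_max_left _ _
  refine le_of_forall_gt_imp_ge_of_dense fun t ht => ?_
  have ht0 : 0 < t := lt_of_le_of_lt (by positivity) ht
  refine u.norm_le_of_modular ht0 ?_
  calc modular p (fun x => t⁻¹ • u x) ≤ ∫⁻ _, ENNReal.ofReal C⁻¹ ∂Ω.vol := by
        refine lintegral_mono_ae ?_
        filter_upwards [h, p.ae_bounds] with x hx hp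
        apply ENNReal.ofReal_le_ofReal
        have h1 : ‖t⁻¹ • u x‖ ≤ C⁻¹ := by
          rw [norm_smul, norm_inv, Real.norm_of_nonneg ht0.le, inv_mul_le_iff₀ ht0,
            ← div_eq_mul_inv, le_div_iff₀ (by positivity)]
          exact (mul_le_mul_of_nonneg_right hx (by positivity)).trans ht.le
        refine (Real.rpow_le_rpow (norm_nonneg _) h1 (by linarith)).trans ?_
        simpa using Real.rpow_le_rpow_of_exponent_ge (by positivity) (inv_le_one_of_one_le₀ hC1)
          hp.1.le
    _ = ENNReal.ofReal C⁻¹ * ENNReal.ofReal (Ω.vol univ).toReal := by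
        rw [lintegral_const, ENNReal.ofReal_toReal (measure_ne_top _ _)]
    _ ≤ 1 := by
        rw [← ENNReal.ofReal_mul (by positivity), ENNReal.ofReal_le_one,
          inv_mul_le_iff₀ (by positivity), mul_one]
        exact le_max_right _ _

/-! ### Hölder's inequality and the duality pairing -/

theorem CPlus.holderConjugate (p : CPlus Ω) {x : Rn N} (hx : 1 < p x) :
    (p.conj x).HolderConjugate (p x) :=
  (Real.HolderConjugate.conjExponent hx).symm

/-- Hölder's inequality in variable exponent Lebesgue spaces. -/
theorem lintegral_norm_mul_norm_le {p : CPlus Ω} (u : Lebesgue F p.conj) (w : Lebesgue G p) :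
    ∫⁻ x, ENNReal.ofReal (‖u x‖ * ‖w x‖) ∂Ω.vol ≤ ENNReal.ofReal (2 * ‖u‖ * ‖w‖) := by
  -- Adding `ε` gives positive scales even for zero norms and avoids asking whether the infimum is
  -- attained. Young's inequality for the normalised functions, with the factors `1/p'` and `1/p`
  -- dropped, yields the constant 2.
  have key : ∀ ε : ℝ, 0 < ε → ∫⁻ x, ENNReal.ofReal (‖u x‖ * ‖w x‖) ∂Ω.vol ≤
      ENNReal.ofReal (2 * (‖u‖ + ε) * (‖w‖ + ε)) := by
    intro ε hε
    obtain ⟨ht, h1⟩ := u.modular_le_one (t := ‖u‖ + ε) (by linarith)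
    obtain ⟨hs, h2⟩ := w.modular_le_one (t := ‖w‖ + ε) (by linarith)
    set t := ‖u‖ + ε
    set s := ‖w‖ + ε
    calc ∫⁻ x, ENNReal.ofReal (‖u x‖ * ‖w x‖) ∂Ω.vol
        ≤ ∫⁻ x, ENNReal.ofReal (t * s) * (ENNReal.ofReal (‖t⁻¹ • u x‖ ^ p.conj x) +
            ENNReal.ofReal (‖s⁻¹ • w x‖ ^ p x)) ∂Ω.vol := by
          refine lintegral_mono_ae ?_
          filter_upwards [p.ae_bounds, p.conj.ae_bounds] with x hp hp'
          rw [← ENNReal.ofReal_add (by positivity) (by positivity),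
            ← ENNReal.ofReal_mul (by positivity)]
          apply ENNReal.ofReal_le_ofReal
          have hy := Real.young_inequality_of_nonneg (norm_nonneg (t⁻¹ • u x))
            (norm_nonneg (s⁻¹ • w x)) (p.holderConjugate hp.1)
          have e : ‖u x‖ * ‖w x‖ = (t * s) * (‖t⁻¹ • u x‖ * ‖s⁻¹ • w x‖) := by
            rw [norm_smul, norm_smul, norm_inv, norm_inv, Real.norm_of_nonneg ht.le,
              Real.norm_of_nonneg hs.le]
            field_simp
          rw [e]
          refine mul_le_mul_of_nonneg_left (hy.trans (add_le_add ?_ ?_)) (by positivity)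
          · exact div_le_self (by positivity) hp'.1.le
          · exact div_le_self (by positivity) hp.1.le
      _ = ENNReal.ofReal (t * s) * (modular p.conj (fun x => t⁻¹ • u x) +
            modular p (fun x => s⁻¹ • w x)) := by
          rw [lintegral_const_mul' _ _ ENNReal.ofReal_ne_top, lintegral_add_left'
            (modular_aemeasurable p.conj (u := fun x => t⁻¹ • u x)
              (u.aestronglyMeasurable.const_smul _))]
          rfl
      _ ≤ ENNReal.ofReal (t * s) * (1 + 1) := by gcongr
      _ = ENNReal.ofReal (2 * t * s) := by
          rw [one_add_one_eq_two, mul_comm, show 2 * t * s = 2 * (t * s) by ring,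
            ENNReal.ofReal_mul (by norm_num : (0 : ℝ) ≤ 2)]
          simp
  have hlim : Tendsto (fun ε : ℝ => ENNReal.ofReal (2 * (‖u‖ + ε) * (‖w‖ + ε))) (𝓝[>] 0)
      (𝓝 (ENNReal.ofReal (2 * (‖u‖ + 0) * (‖w‖ + 0)))) :=
    (ENNReal.continuous_ofReal.comp (by fun_prop)).continuousAt.tendsto.mono_left
      nhdsWithin_le_nhds
  simp only [add_zero] at hlim
  exact ge_of_tendsto hlim (eventually_mem_nhdsWithin.mono fun ε hε => key ε hε)

theorem integrable_norm_mul_norm {p : CPlus Ω} (u : Lebesgue F p.conj) (w : Lebesgue G p) :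
    Integrable (fun x => ‖u x‖ * ‖w x‖) Ω.vol := by
  refine ⟨u.aestronglyMeasurable.norm.mul w.aestronglyMeasurable.norm, ?_⟩
  rw [hasFiniteIntegral_iff_ofReal (Eventually.of_forall fun x => by positivity)]
  exact (lintegral_norm_mul_norm_le u w).trans_lt ENNReal.ofReal_lt_top

theorem integral_norm_mul_norm_le {p : CPlus Ω} (u : Lebesgue F p.conj) (w : Lebesgue G p) :
    ∫ x, ‖u x‖ * ‖w x‖ ∂Ω.vol ≤ 2 * ‖u‖ * ‖w‖ := by
  rw [integral_eq_lintegral_of_nonneg_ae (Eventually.of_forall fun x => by positivity)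
    (integrable_norm_mul_norm u w).aestronglyMeasurable]
  exact ENNReal.toReal_le_of_le_ofReal (by positivity) (lintegral_norm_mul_norm_le u w)

theorem integrable_mul {p : CPlus Ω} (u : Lebesgue ℝ p.conj) (w : Lebesgue ℝ p) :
    Integrable (fun x => u x * w x) Ω.vol := by
  refine (integrable_norm_mul_norm u w).mono'
    (u.aestronglyMeasurable.mul w.aestronglyMeasurable) (Eventually.of_forall fun x => ?_)
  rw [norm_mul]

theorem norm_integral_mul_le {p : CPlus Ω} (u : Lebesgue ℝ p.conj) (w : Lebesgue ℝ p) :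
    ‖∫ x, u x * w x ∂Ω.vol‖ ≤ 2 * ‖u‖ * ‖w‖ := by
  refine (norm_integral_le_integral_norm _).trans (le_trans (le_of_eq ?_)
    (integral_norm_mul_norm_le u w))
  simp only [norm_mul]

theorem Lebesgue.integrable {p : CPlus Ω} (w : Lebesgue F p) : Integrable w Ω.vol := by
  -- Hölder's inequality against the constant function 1, which lies in the conjugate space because
  -- `Ω` has finite volume.
  have hb : ∀ᵐ x ∂Ω.vol, ‖(1 : ℝ)‖ ≤ 1 := Eventually.of_forall fun x => by simp
  set e : Lebesgue ℝ p.conj := Lebesgue.mk (fun _ => 1) aestronglyMeasurable_const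
    (modular_lt_top_of_bound p.conj hb)
  refine (integrable_norm_mul_norm e w).mono' w.aestronglyMeasurable ?_
  filter_upwards [Lebesgue.coeFn_mk (p := p.conj) (fun _ => (1 : ℝ)) aestronglyMeasurable_const
    (modular_lt_top_of_bound p.conj hb)] with x hx
  rw [hx]
  simp

theorem Lebesgue.integral_norm_le {p : CPlus Ω} (w : Lebesgue F p) :
    ∫ x, ‖w x‖ ∂Ω.vol ≤ 2 * max 1 (Ω.vol univ).toReal * ‖w‖ := by
  have hb : ∀ᵐ x ∂Ω.vol, ‖(1 : ℝ)‖ ≤ 1 := Eventually.of_forall fun x => by simp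
  set e : Lebesgue ℝ p.conj := Lebesgue.mk (fun _ => 1) aestronglyMeasurable_const
    (modular_lt_top_of_bound p.conj hb) with he
  have hae : ⇑e =ᵐ[Ω.vol] fun _ => 1 := Lebesgue.coeFn_mk _ _ _
  have hn : ‖e‖ ≤ 1 * max 1 (Ω.vol univ).toReal := by
    refine e.norm_le_of_bound zero_le_one ?_
    filter_upwards [hae] with x hx
    simp [hx]
  calc ∫ x, ‖w x‖ ∂Ω.vol = ∫ x, ‖e x‖ * ‖w x‖ ∂Ω.vol := by
        refine integral_congr_ae ?_
        filter_upwards [hae] with x hx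
        simp [hx]
    _ ≤ 2 * ‖e‖ * ‖w‖ := integral_norm_mul_norm_le e w
    _ ≤ _ := by gcongr; simpa using hn

/-- The embedding `L^{p'(x)}(Ω) → W^{-1,p'(x)}(Ω)`, `h ↦ (φ ↦ ∫ h φ)`. -/
def pairing (p : CPlus Ω) : Lebesgue ℝ p.conj →L[ℝ] DualSobolev p :=
  LinearMap.mkContinuous₂
    (LinearMap.mk₂ ℝ (fun (h : Lebesgue ℝ p.conj) (φ : Sobolev p) => ∫ x, h x * φ x ∂Ω.vol)
      (fun h k φ => by
        rw [← integral_add (integrable_mul _ _) (integrable_mul _ _)]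
        refine integral_congr_ae ?_
        filter_upwards [Lebesgue.coeFn_add h k] with x hx
        rw [hx]; ring)
      (fun c h φ => by
        rw [smul_eq_mul, ← integral_const_mul]
        refine integral_congr_ae ?_
        filter_upwards [Lebesgue.coeFn_smul c h] with x hx
        rw [hx, smul_eq_mul]; ring)
      (fun h φ ψ => by
        rw [← integral_add (integrable_mul _ _) (integrable_mul _ _)]
        refine integral_congr_ae ?_
        filter_upwards [Lebesgue.coeFn_add (Sobolev.toLebesgue p φ) (Sobolev.toLebesgue p ψ)]
          with x hx
        rw [map_add, hx]; ring)
      (fun c h φ => by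
        rw [smul_eq_mul, ← integral_const_mul]
        refine integral_congr_ae ?_
        filter_upwards [Lebesgue.coeFn_smul c (Sobolev.toLebesgue p φ)] with x hx
        rw [map_smul, hx, smul_eq_mul]; ring))
    2 (fun h φ => by
      refine (norm_integral_mul_le h (Sobolev.toLebesgue p φ)).trans ?_
      gcongr
      rw [Sobolev.norm_def]
      exact le_add_of_nonneg_right (norm_nonneg _))

theorem pairing_apply {p : CPlus Ω} (h : Lebesgue ℝ p.conj) (φ : Sobolev p) :
    pairing p h φ = ∫ x, h x * φ x ∂Ω.vol := rfl

end LebesgueTools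


/-! ### Interior compactness in the dual Sobolev space, by mollification. -/

section LocalRellich

variable {N : ℕ} {Ω : LipDomain N}

theorem totallyBounded_of_approx {α : Type*} [PseudoMetricSpace α] {s : Set α}
    (h : ∀ ε > 0, ∃ t, TotallyBounded t ∧ ∀ x ∈ s, ∃ y ∈ t, dist x y ≤ ε) :
    TotallyBounded s := by
  rw [Metric.totallyBounded_iff]
  intro ε hε
  obtain ⟨t, ht, hst⟩ := h (ε / 2) (half_pos hε)
  obtain ⟨c, hc, htc⟩ := Metric.totallyBounded_iff.1 ht (ε / 2) (half_pos hε)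
  refine ⟨c, hc, fun x hx => ?_⟩
  obtain ⟨y, hy, hxy⟩ := hst x hx
  obtain ⟨z, hz, hyz⟩ := mem_iUnion₂.1 (htc hy)
  refine mem_iUnion₂.2 ⟨z, hz, ?_⟩
  rw [Metric.mem_ball] at hyz ⊢
  linarith [dist_triangle x y z]

/-! ### Translations and mollification against weakly differentiable functions -/

theorem IsWeakGradient.integral_mul_fderiv {U : Set (Rn N)} {u : Rn N → ℝ} {g : Rn N → Rn N}
    (hw : IsWeakGradient U u g) {φ : Rn N → ℝ} (h1 : ContDiff ℝ ∞ φ) (h2 : HasCompactSupport φ)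
    (h3 : tsupport φ ⊆ U) (v : Rn N) :
    ∫ x in U, u x * fderiv ℝ φ x v = -∫ x in U, inner ℝ v (g x) * φ x := by
  have hv : v = ∑ i, v i • EuclideanSpace.single i (1 : ℝ) := by
    have := (EuclideanSpace.basisFun (Fin N) ℝ).sum_repr v
    simpa using this.symm
  have e1 : ∀ x, u x * fderiv ℝ φ x v =
      ∑ i, v i * (u x * fderiv ℝ φ x (EuclideanSpace.single i 1)) := by
    intro x
    conv_lhs => rw [hv]
    rw [map_sum, Finset.mul_sum]
    refine Finset.sum_congr rfl fun i _ => ?_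
    rw [map_smul, smul_eq_mul]; ring
  have e2 : ∀ x, inner ℝ v (g x) * φ x = ∑ i, v i * (g x i * φ x) := by
    intro x
    rw [PiLp.inner_apply, Finset.sum_mul]
    refine Finset.sum_congr rfl fun i _ => ?_
    simp only [RCLike.inner_apply, conj_trivial]; ring
  simp only [e1, e2]
  rw [integral_finsetSum _ fun i _ => (integrable_mul_dtest hw.locInt h1 h2 h3 _).const_mul _,
    integral_finsetSum _ fun i _ => (integrable_mul_test (locInt_coord hw.locInt_grad i)
      h1.continuous h2 h3).const_mul _, ← Finset.sum_neg_distrib]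
  refine Finset.sum_congr rfl fun i _ => ?_
  rw [integral_const_mul, integral_const_mul, hw.integral_eq φ h1 h2 h3 i]
  ring

/-- Differentiate `t ↦ ∫ h(x - t y) u(x) dx` and integrate by parts. The derivative falls on `u`, so
the bound involves only the supremum of `h`, not its smoothness; this is what makes it uniform over
families of test functions. -/
theorem norm_integral_translate_sub_le {U : Set (Rn N)} {u : Rn N → ℝ} {g : Rn N → Rn N}
    (hw : IsWeakGradient U u g) (hu : IntegrableOn u U) (hg : IntegrableOn g U)
    {h : Rn N → ℝ} (hh : ContDiff ℝ ∞ h) (hc : HasCompactSupport h) {M : ℝ}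
    (hM : ∀ x, |h x| ≤ M) {δ : ℝ} (hs : Metric.cthickening δ (tsupport h) ⊆ U) {y : Rn N}
    (hy : ‖y‖ ≤ δ) :
    ‖(∫ x in U, h (x - y) * u x) - ∫ x in U, h x * u x‖ ≤ ‖y‖ * M * ∫ x in U, ‖g x‖ := by
  -- The Lipschitz constant of `h` serves only to dominate the differentiation under the integral;
  -- it does not enter the final estimate.
  obtain ⟨C, hC⟩ := ContDiff.lipschitzWith_of_hasCompactSupport hc hh (by simp)
  have hD : ∀ x, ‖fderiv ℝ h x‖ ≤ C := fun x => norm_fderiv_le_of_lipschitz ℝ hC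
  have hcont : ∀ t : ℝ, Continuous fun x => h (x - t • y) := fun t =>
    hh.continuous.comp (by fun_prop)
  have hcontD : ∀ t : ℝ, Continuous fun x => fderiv ℝ h (x - t • y) y := fun t =>
    ((hh.continuous_fderiv (by simp)).comp (by fun_prop)).clm_apply continuous_const
  have hderiv : ∀ t : ℝ, HasDerivAt (fun t : ℝ => ∫ x in U, h (x - t • y) * u x)
      (∫ x in U, -(fderiv ℝ h (x - t • y) y) * u x) t := by
    intro t
    refine (hasDerivAt_integral_of_dominated_loc_of_deriv_le (s := univ)
      (F := fun (t : ℝ) (x : Rn N) => h (x - t • y) * u x)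
      (F' := fun (t : ℝ) (x : Rn N) => -(fderiv ℝ h (x - t • y) y) * u x)
      (bound := fun x => C * ‖y‖ * ‖u x‖) univ_mem ?_ ?_ ?_ ?_ ?_ ?_).2
    · exact Eventually.of_forall fun s =>
        (hcont s).aestronglyMeasurable.mul hu.aestronglyMeasurable
    · exact hu.bdd_mul (c := M) (hcont t).aestronglyMeasurable
        (Eventually.of_forall fun x => hM _)
    · exact (hcontD t).neg.aestronglyMeasurable.mul hu.aestronglyMeasurable
    · refine Eventually.of_forall fun x s _ => ?_
      rw [norm_mul, norm_neg]
      gcongr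
      exact ((fderiv ℝ h (x - s • y)).le_opNorm y).trans (by gcongr; exact hD _)
    · exact hu.norm.const_mul _
    · refine Eventually.of_forall fun x s _ => ?_
      have h1 : HasDerivAt (fun s : ℝ => x - s • y) (-y) s := by
        simpa using ((hasDerivAt_id s).smul_const y).const_sub x
      have h2 := ((hh.differentiable (by simp)) (x - s • y)).hasFDerivAt.comp_hasDerivAt s h1
      rw [map_neg] at h2
      exact h2.mul_const (u x)
  have hbound : ∀ t ∈ Ico (0 : ℝ) 1, ‖∫ x in U, -(fderiv ℝ h (x - t • y) y) * u x‖ ≤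
      ‖y‖ * M * ∫ x in U, ‖g x‖ := by
    intro t ht
    set ht' : Rn N → ℝ := fun x => h (x - t • y) with hdef
    have hsm : ContDiff ℝ ∞ ht' := hh.comp (by fun_prop)
    have hsupp : tsupport ht' = (Homeomorph.subRight (t • y)) ⁻¹' tsupport h :=
      tsupport_comp_eq_preimage h (Homeomorph.subRight (t • y))
    have hcs : HasCompactSupport ht' := hc.comp_homeomorph (Homeomorph.subRight (t • y))
    -- The translates along the whole segment remain admissible test functions because the
    -- `δ`-thickening of the support of `h` lies in `U`.
    have hsub : tsupport ht' ⊆ U := by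
      intro x hx
      rw [hsupp] at hx
      refine hs (Metric.mem_cthickening_of_dist_le x (x - t • y) δ _ hx ?_)
      rw [dist_eq_norm, sub_sub_cancel, norm_smul, Real.norm_of_nonneg ht.1]
      exact (mul_le_of_le_one_left (norm_nonneg _) ht.2.le).trans hy
    have hfd : ∀ x, fderiv ℝ ht' x y = fderiv ℝ h (x - t • y) y := by
      intro x
      exact congrArg (fun T : Rn N →L[ℝ] ℝ => T y) (fderiv_comp_sub (f := h) (x := x) (t • y))
    have e : ∫ x in U, -(fderiv ℝ h (x - t • y) y) * u x = ∫ x in U, inner ℝ y (g x) * ht' x := by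
      rw [← neg_neg (∫ x in U, inner ℝ y (g x) * ht' x),
        ← hw.integral_mul_fderiv hsm hcs hsub y, ← integral_neg]
      refine integral_congr_ae (Eventually.of_forall fun x => ?_)
      simp only [hfd]
      ring
    rw [e, ← integral_const_mul]
    refine norm_integral_le_of_norm_le (hg.norm.const_mul _) (Eventually.of_forall fun x => ?_)
    rw [norm_mul, mul_right_comm]
    exact mul_le_mul (norm_inner_le_norm _ _) (hM _) (norm_nonneg _) (by positivity)
  have := norm_image_sub_le_of_norm_deriv_le_segment_01'
    (fun t _ => (hderiv t).hasDerivWithinAt) hbound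
  simpa using this

/-- By Fubini, pairing with the mollification is an average of pairings with translates, against a
probability density carried by the ball of radius `η.rOut`. The translation estimate is then
averaged. -/
theorem norm_integral_mollify_sub_le {U : Set (Rn N)} {u : Rn N → ℝ} {g : Rn N → Rn N}
    (hw : IsWeakGradient U u g) (hu : IntegrableOn u U) (hg : IntegrableOn g U)
    {h : Rn N → ℝ} (hh : ContDiff ℝ ∞ h) (hc : HasCompactSupport h) {M : ℝ}
    (hM : ∀ x, |h x| ≤ M) (η : ContDiffBump (0 : Rn N))
    (hs : Metric.cthickening η.rOut (tsupport h) ⊆ U) :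
    ‖(∫ x in U, convolution (η.normed volume) h (ContinuousLinearMap.lsmul ℝ ℝ) volume x * u x) -
      ∫ x in U, h x * u x‖ ≤ η.rOut * M * ∫ x in U, ‖g x‖ := by
  have hM0 : 0 ≤ M := (abs_nonneg _).trans (hM 0)
  have hint : Integrable (Function.uncurry fun (x y : Rn N) => η.normed volume y *
      (h (x - y) * u x)) ((volume.restrict U).prod volume) := by
    have h1 : Integrable (fun z : Rn N × Rn N => u z.1 * η.normed volume z.2)
        ((volume.restrict U).prod volume) := Integrable.mul_prod hu η.integrable_normed
    have h2 := h1.bdd_mul (c := M) (f := fun z : Rn N × Rn N => h (z.1 - z.2))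
      ((hh.continuous.comp (by fun_prop : Continuous fun z : Rn N × Rn N => z.1 - z.2))
        |>.aestronglyMeasurable) (Eventually.of_forall fun z => hM _)
    refine h2.congr (Eventually.of_forall fun z => ?_)
    simp only [Function.uncurry]
    ring
  have e1 : ∫ x in U, convolution (η.normed volume) h (ContinuousLinearMap.lsmul ℝ ℝ) volume x *
      u x = ∫ y, η.normed volume y * ∫ x in U, h (x - y) * u x := by
    simp only [← integral_const_mul]
    rw [← integral_integral_swap hint]
    refine integral_congr_ae (Eventually.of_forall fun x => ?_)
    simp only [convolution_def, ContinuousLinearMap.lsmul_apply, smul_eq_mul]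
    rw [← integral_mul_const]
    simp only [mul_assoc]
  have e2 : ∫ x in U, h x * u x = ∫ y, η.normed volume y * ∫ x in U, h x * u x := by
    rw [integral_mul_const, η.integral_normed, one_mul]
  have i1 : Integrable (fun y => η.normed volume y * ∫ x in U, h (x - y) * u x) := by
    simp only [← integral_const_mul]
    exact hint.integral_prod_right
  rw [e1, e2, ← integral_sub i1 (η.integrable_normed.mul_const _)]
  have hb : ∀ y, ‖η.normed volume y * (∫ x in U, h (x - y) * u x) -
      η.normed volume y * ∫ x in U, h x * u x‖ ≤
        η.normed volume y * (η.rOut * M * ∫ x in U, ‖g x‖) := by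
    intro y
    rw [← mul_sub, norm_mul, Real.norm_of_nonneg (η.nonneg_normed y)]
    by_cases hy : y ∈ Function.support (η.normed volume)
    · rw [η.support_normed_eq, mem_ball_zero_iff] at hy
      refine mul_le_mul_of_nonneg_left ?_ (η.nonneg_normed y)
      refine (norm_integral_translate_sub_le hw hu hg hh hc hM hs hy.le).trans ?_
      gcongr
    · rw [Function.notMem_support.1 hy]
      simp
  refine (norm_integral_le_of_norm_le (η.integrable_normed.mul_const _)
    (Eventually.of_forall hb)).trans (le_of_eq ?_)
  rw [integral_mul_const, η.integral_normed, one_mul]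

theorem abs_convolution_normed_le {h : Rn N → ℝ} (hm : AEStronglyMeasurable h volume) {M : ℝ}
    (hM : ∀ x, |h x| ≤ M) (η : ContDiffBump (0 : Rn N)) (x : Rn N) :
    |convolution (η.normed volume) h (ContinuousLinearMap.lsmul ℝ ℝ) volume x| ≤ M := by
  have := dist_convolution_le (μ := volume) (f := η.normed volume) (x₀ := x) (z₀ := (0 : ℝ))
    (R := η.rOut) ((abs_nonneg _).trans (hM 0)) η.support_normed_eq.subset η.nonneg_normed
    η.integral_normed hm (fun y _ => by simpa using hM y)
  simpa using this

/-- The increment falls on the kernel, so the Lipschitz constant depends on `η`, `M` and the volume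
of `U`, but not on `h`. -/
theorem exists_lipschitzWith_mollify (η : ContDiffBump (0 : Rn N)) {U : Set (Rn N)}
    (hU : volume U ≠ ⊤) (hUm : MeasurableSet U) (M : ℝ) : ∃ L : NNReal, ∀ h : Rn N → ℝ,
      AEStronglyMeasurable h volume → (∀ x, |h x| ≤ M) → Function.support h ⊆ U →
      LipschitzWith L (convolution (η.normed volume) h (ContinuousLinearMap.lsmul ℝ ℝ)
        volume) := by
  obtain ⟨C, hC⟩ := ContDiff.lipschitzWith_of_hasCompactSupport
    (f := η.normed volume) (𝕂 := ℝ) η.hasCompactSupport_normed (η.contDiff_normed (n := 1))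
    (by simp)
  refine ⟨(C * M * volume.real U).toNNReal, fun h hm hM hs => ?_⟩
  refine LipschitzWith.of_dist_le_mul fun x x' => ?_
  have hM0 : 0 ≤ M := (abs_nonneg _).trans (hM 0)
  have hint : Integrable h := by
    rw [← integrableOn_iff_integrable_of_support_subset hs]
    exact Measure.integrableOn_of_bounded (M := M) hU hm (Eventually.of_forall fun x => hM x)
  have hi : ∀ x, Integrable fun t => η.normed volume (x - t) * h t := by
    intro x
    have hcont : Continuous fun t => η.normed volume (x - t) :=
      η.continuous_normed.comp (by fun_prop)
    obtain ⟨B, hB⟩ := η.hasCompactSupport_normed.exists_bound_of_continuous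
      (η.continuous_normed (μ := volume))
    exact hint.bdd_mul hcont.aestronglyMeasurable (Eventually.of_forall fun t => hB _)
  rw [convolution_eq_swap, convolution_eq_swap, dist_eq_norm, Real.coe_toNNReal _ (by positivity)]
  simp only [ContinuousLinearMap.lsmul_apply, smul_eq_mul]
  rw [← integral_sub (hi x) (hi x')]
  have hb : ∀ t, ‖η.normed volume (x - t) * h t - η.normed volume (x' - t) * h t‖ ≤
      U.indicator (fun _ => C * M * dist x x') t := by
    intro t
    by_cases ht : t ∈ U
    · rw [indicator_of_mem ht, ← sub_mul, norm_mul, mul_right_comm]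
      refine mul_le_mul ?_ (hM t) (norm_nonneg _) (by positivity)
      rw [← dist_eq_norm]
      simpa using hC.dist_le_mul (x - t) (x' - t)
    · rw [indicator_of_notMem ht, Function.notMem_support.1 fun h' => ht (hs h')]
      simp
  have hii : Integrable (U.indicator fun _ => C * M * dist x x') :=
    (integrableOn_const hU).integrable_indicator hUm
  refine (norm_integral_le_of_norm_le hii (Eventually.of_forall hb)).trans (le_of_eq ?_)
  rw [integral_indicator hUm, setIntegral_const, smul_eq_mul]
  ring

/-! ### Compactness of families of Lipschitz functions -/

/-- Arzelà–Ascoli on the compact closure of `Ω`, transported by the map from continuous functions to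
`L^{p(x)}`, which is Lipschitz by `Lebesgue.norm_le_of_bound`. -/
theorem totallyBounded_lipschitz (p : CPlus Ω) (L : NNReal) (M : ℝ) :
    TotallyBounded {w : Lebesgue ℝ p | ∃ k : Rn N → ℝ, LipschitzWith L k ∧ (∀ x, |k x| ≤ M) ∧
      w =ᵐ[Ω.vol] k} := by
  have : CompactSpace (closure Ω.carrier) := isCompact_iff_compactSpace.1 Ω.isCompact_closure
  let A : Set (BoundedContinuousFunction (closure Ω.carrier) ℝ) :=
    {k | LipschitzWith L k ∧ ∀ x, |k x| ≤ M}
  have hA : TotallyBounded A := by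
    refine totallyBounded_closure.1 (IsCompact.totallyBounded
      (BoundedContinuousFunction.arzela_ascoli (Icc (-M) M) isCompact_Icc A
        (fun k x hk => abs_le.1 (hk.2 x)) ?_))
    exact (LipschitzWith.uniformEquicontinuous (fun k : A => (k.1 : closure Ω.carrier → ℝ)) L
      fun k => k.2.1).equicontinuous
  let e : BoundedContinuousFunction (closure Ω.carrier) ℝ → Rn N → ℝ :=
    fun k => Function.extend Subtype.val k 0
  have he : ∀ k, ∀ x (hx : x ∈ closure Ω.carrier), e k x = k ⟨x, hx⟩ := fun k x hx =>
    Subtype.val_injective.extend_apply k 0 ⟨x, hx⟩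
  have hmem : ∀ᵐ x ∂Ω.vol, x ∈ closure Ω.carrier :=
    (ae_restrict_mem Ω.isOpen.measurableSet).mono fun x hx => subset_closure hx
  have hem : ∀ k, AEStronglyMeasurable (e k) Ω.vol := by
    intro k
    refine ContinuousOn.aestronglyMeasurable (ContinuousOn.mono ?_ subset_closure)
      Ω.isOpen.measurableSet
    rw [continuousOn_iff_continuous_domRestrict]
    exact k.continuous.congr fun x => (he k x.1 x.2).symm
  have heb : ∀ k, ∀ᵐ x ∂Ω.vol, ‖e k x‖ ≤ ‖k‖ := fun k => hmem.mono fun x hx => by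
    rw [he k x hx]; exact k.norm_coe_le_norm _
  let E : BoundedContinuousFunction (closure Ω.carrier) ℝ → Lebesgue ℝ p := fun k =>
    Lebesgue.mk (e k) (hem k) (modular_lt_top_of_bound p (heb k))
  have hE : ∀ k, ⇑(E k) =ᵐ[Ω.vol] e k := fun k => Lebesgue.coeFn_mk _ _ _
  have hEl : UniformContinuous E := by
    refine (LipschitzWith.of_dist_le_mul (K := (max 1 (Ω.vol univ).toReal).toNNReal)
      fun k l => ?_).uniformContinuous
    rw [dist_eq_norm, Real.coe_toNNReal _ (by positivity), mul_comm]
    refine Lebesgue.norm_le_of_bound _ dist_nonneg ?_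
    filter_upwards [Lebesgue.coeFn_sub (E k) (E l), hE k, hE l, hmem] with x h1 h2 h3 hx
    rw [h1, h2, h3, he k x hx, he l x hx, ← dist_eq_norm]
    exact BoundedContinuousFunction.dist_coe_le_dist _
  refine (hA.image hEl).subset ?_
  rintro w ⟨k, hkL, hkM, hwk⟩
  have hkL' : LipschitzWith L fun x : closure Ω.carrier => k x.1 := fun x y => hkL x.1 y.1
  let k' : BoundedContinuousFunction (closure Ω.carrier) ℝ :=
    BoundedContinuousFunction.mkOfCompact ⟨fun x => k x.1, hkL'.continuous⟩
  refine ⟨k', ⟨hkL', fun x => hkM x.1⟩, Lebesgue.ext ?_⟩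
  filter_upwards [hE k', hwk, hmem] with x h1 h2 hx
  rw [h1, h2, he k' x hx]
  rfl

/-! ### Approximation by smooth functions with compact support -/

/-- Mollification at a scale depending on `g`: it gives no common Lipschitz bound, but turns `g`
into a test function while keeping the bound `M` and nearly the same support. Convergence in modular
is dominated convergence. -/
theorem exists_smooth_approx {p : CPlus Ω} {K : Set (Rn N)} (hK : IsCompact K) {M : ℝ}
    (hM : 0 ≤ M) {g : Lebesgue ℝ p} (hgM : ∀ᵐ x ∂Ω.vol, |g x| ≤ M)
    (hgK : ∀ᵐ x ∂Ω.vol, x ∉ K → g x = 0) {δ : ℝ} (hδ : 0 < δ) {ε : ℝ} (hε : 0 < ε) :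
    ∃ (h : Rn N → ℝ) (w : Lebesgue ℝ p), ContDiff ℝ ∞ h ∧ (∀ x, |h x| ≤ M) ∧
      tsupport h ⊆ Metric.cthickening δ K ∧ w =ᵐ[Ω.vol] h ∧ ‖g - w‖ ≤ ε := by
  -- A representative that satisfies the bound and vanishes off `K` everywhere, so that it can be
  -- convolved on the whole space.
  set g' : Rn N → ℝ := K.indicator fun x => max (-M) (min M (g x)) with hg'
  have hm : StronglyMeasurable g' := by
    refine StronglyMeasurable.indicator ?_ hK.measurableSet
    exact stronglyMeasurable_const.sup (stronglyMeasurable_const.inf g.toAEEqFun.stronglyMeasurable)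
  have hb : ∀ x, |g' x| ≤ M := by
    intro x
    by_cases hx : x ∈ K
    · rw [hg', indicator_of_mem hx, abs_le]
      exact ⟨le_max_left _ _, max_le (by linarith) (min_le_left _ _)⟩
    · rw [hg', indicator_of_notMem hx, abs_zero]
      exact hM
  have hgg' : ∀ᵐ x ∂Ω.vol, g x = g' x := by
    filter_upwards [hgM, hgK] with x h1 h2
    by_cases hx : x ∈ K
    · rw [hg', indicator_of_mem hx, min_eq_right (abs_le.1 h1).2, max_eq_right (abs_le.1 h1).1]
    · rw [hg', indicator_of_notMem hx, h2 hx]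
  have hsupp : Function.support g' ⊆ K := support_indicator_subset
  have hint : Integrable g' := by
    rw [← integrableOn_iff_integrable_of_support_subset hsupp]
    exact Measure.integrableOn_of_bounded (M := M) hK.measure_ne_top hm.aestronglyMeasurable
      (Eventually.of_forall fun x => hb x)
  have hpos : ∀ n : ℕ, 0 < δ / (n + 1) := fun n => by positivity
  let η : ℕ → ContDiffBump (0 : Rn N) := fun n =>
    ⟨δ / (n + 1) / 2, δ / (n + 1), half_pos (hpos n), half_lt_self (hpos n)⟩
  let h : ℕ → Rn N → ℝ := fun n =>
    convolution ((η n).normed volume) g' (ContinuousLinearMap.lsmul ℝ ℝ) volume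
  have hlim : ∀ᵐ x, Tendsto (fun n => h n x) atTop (𝓝 (g' x)) := by
    refine ContDiffBump.ae_convolution_tendsto_right_of_locallyIntegrable (K := 2) ?_ ?_
      hint.locallyIntegrable
    · exact tendsto_const_div_atTop_nhds_zero_nat δ |>.comp (tendsto_add_atTop_nat 1) |>.congr
        fun n => by simp [η]
    · refine Eventually.of_forall fun n => ?_
      change δ / (n + 1) ≤ 2 * (δ / (n + 1) / 2)
      linarith
  have hsm : ∀ n, ContDiff ℝ ∞ (h n) := fun n =>
    (η n).hasCompactSupport_normed.contDiff_convolution_left _ (η n).contDiff_normed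
      hint.locallyIntegrable
  have hhM : ∀ n x, |h n x| ≤ M := fun n x =>
    abs_convolution_normed_le hm.aestronglyMeasurable hb (η n) x
  have hts : ∀ n, tsupport (h n) ⊆ Metric.cthickening δ K := by
    intro n
    refine closure_minimal ?_ Metric.isClosed_cthickening
    refine (support_convolution_subset _).trans ?_
    rintro _ ⟨a, ha, b, hb, rfl⟩
    rw [(η n).support_normed_eq, mem_ball_zero_iff] at ha
    refine Metric.mem_cthickening_of_dist_le _ b δ _ (hsupp hb) ?_
    simp only [dist_eq_norm, add_sub_cancel_right]
    refine ha.le.trans (div_le_self hδ.le ?_)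
    have : (0 : ℝ) ≤ n := n.cast_nonneg
    linarith
  let w : ℕ → Lebesgue ℝ p := fun n => Lebesgue.mk (h n) (hsm n).continuous.aestronglyMeasurable
    (modular_lt_top_of_bound p (Eventually.of_forall (hhM n)))
  have hw : ∀ n, ⇑(w n) =ᵐ[Ω.vol] h n := fun n => Lebesgue.coeFn_mk _ _ _
  have hmod : Tendsto (fun n => modular p ⇑(g - w n)) atTop (𝓝 0) := by
    have e : ∀ n, modular p ⇑(g - w n) = modular p fun x => g' x - h n x := fun n => by
      refine modular_congr p ?_
      filter_upwards [Lebesgue.coeFn_sub g (w n), hw n, hgg'] with x h1 h2 h3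
      rw [h1, h2, h3]
    simp only [e]
    have hz : (0 : ENNReal) = ∫⁻ _, 0 ∂Ω.vol := by simp
    rw [hz]
    refine tendsto_lintegral_of_dominated_convergence'
      (fun _ => ENNReal.ofReal (max 1 (M + M) ^ p.upper)) (fun n => ?_) (fun n => ?_) ?_ ?_
    · exact modular_aemeasurable p (hm.aestronglyMeasurable.sub
        (hsm n).continuous.aestronglyMeasurable)
    · filter_upwards [p.ae_bounds] with x hp
      apply ENNReal.ofReal_le_ofReal
      refine (Real.rpow_le_rpow (norm_nonneg _) ((norm_sub_le _ _).trans
        (add_le_add (hb x) (hhM n x))) (by linarith)).trans ?_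
      exact rpow_le_max_rpow p hp (by positivity)
    · rw [lintegral_const]
      exact (ENNReal.mul_lt_top ENNReal.ofReal_lt_top (measure_lt_top _ _)).ne
    · filter_upwards [p.ae_bounds, ae_restrict_of_ae hlim] with x hp hx
      have h1 : Tendsto (fun n => ‖g' x - h n x‖) atTop (𝓝 0) := by
        simpa using ((tendsto_const_nhds (x := g' x)).sub hx).norm
      have h2 := h1.rpow_const (p := p x) (Or.inr (by linarith))
      rw [Real.zero_rpow (by linarith)] at h2
      simpa using ENNReal.tendsto_ofReal h2
  obtain ⟨n, hn⟩ := ((tendsto_norm_of_tendsto_modular hmod).eventually_le_const hε).exists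
  exact ⟨h n, w n, hsm n, hhM n, hts n, hw n, hn⟩

/-- Compactness, in the dual of `W^{1,p(x)}`, of the functionals given by uniformly bounded
functions that vanish off a fixed compact subset of `Ω`. -/
theorem totallyBounded_pairing_image (p : CPlus Ω) {K : Set (Rn N)} (hK : IsCompact K)
    (hKΩ : K ⊆ Ω.carrier) {M : ℝ} (hM : 0 ≤ M) :
    TotallyBounded (pairing p '' {g | (∀ᵐ x ∂Ω.vol, |g x| ≤ M) ∧
      ∀ᵐ x ∂Ω.vol, x ∉ K → g x = 0}) := by
  obtain ⟨d, hd, hdΩ⟩ := hK.exists_cthickening_subset_open Ω.isOpen hKΩ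
  refine totallyBounded_of_approx fun ε hε => ?_
  set C := max 1 (Ω.vol univ).toReal
  have hC : 0 < C := lt_max_of_lt_left one_pos
  -- The scale is fixed before `g`. The first bound keeps the `r`-thickening of the support of `h`,
  -- itself within `d / 2` of `K`, inside `Ω`. The second makes the mollification error at most `ε /
  -- 2`, where `2 * C` bounds the `L¹` norm of the gradient by its Luxemburg norm.
  set r := min (d / 2) (ε / 2 / (M * (2 * C) + 1)) with hr
  have hr0 : 0 < r := by positivity
  have hrd : r ≤ d / 2 := min_le_left _ _
  have hrε : r * M * (2 * C) ≤ ε / 2 := by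
    have : r ≤ ε / 2 / (M * (2 * C) + 1) := min_le_right _ _
    rw [le_div_iff₀ (by positivity)] at this
    nlinarith
  let η : ContDiffBump (0 : Rn N) := ⟨r / 2, r, half_pos hr0, half_lt_self hr0⟩
  obtain ⟨L, hL⟩ := exists_lipschitzWith_mollify η Ω.isBounded.measure_lt_top.ne
    Ω.isOpen.measurableSet M
  refine ⟨pairing p '' _, (totallyBounded_lipschitz p.conj L M).image
    (pairing p).uniformContinuous, ?_⟩
  rintro _ ⟨g, ⟨hgM, hgK⟩, rfl⟩
  obtain ⟨h, w, hh, hhM, hhs, hwh, hgw⟩ := exists_smooth_approx hK hM hgM hgK (half_pos hd)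
    (ε := ε / 2 / (‖pairing p‖ + 1)) (by positivity)
  have hthick : Metric.cthickening r (tsupport h) ⊆ Ω.carrier := by
    refine subset_trans ?_ hdΩ
    refine (Metric.cthickening_subset_of_subset r hhs).trans
      ((Metric.cthickening_cthickening_subset hr0.le (half_pos hd).le K).trans
        (Metric.cthickening_mono (by linarith) K))
  have hsub : tsupport h ⊆ Ω.carrier := (Metric.self_subset_cthickening _).trans hthick
  have hhc : HasCompactSupport h :=
    hK.cthickening.of_isClosed_subset (isClosed_tsupport h) hhs
  set k := convolution (η.normed volume) h (ContinuousLinearMap.lsmul ℝ ℝ) volume with hk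
  have hkL : LipschitzWith L k := hL h hh.continuous.aestronglyMeasurable hhM
    ((subset_tsupport h).trans hsub)
  have hkM : ∀ x, |k x| ≤ M := abs_convolution_normed_le hh.continuous.aestronglyMeasurable hhM η
  set v : Lebesgue ℝ p.conj := Lebesgue.mk k hkL.continuous.aestronglyMeasurable
    (modular_lt_top_of_bound p.conj (Eventually.of_forall hkM))
  have hvk : ⇑v =ᵐ[Ω.vol] k := Lebesgue.coeFn_mk _ _ _
  refine ⟨pairing p v, ⟨v, ⟨k, hkL, hkM, hvk⟩, rfl⟩, ?_⟩
  have d1 : dist (pairing p g) (pairing p w) ≤ ε / 2 := by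
    rw [dist_eq_norm, ← map_sub]
    refine ((pairing p).le_opNorm _).trans ((mul_le_mul_of_nonneg_left hgw (norm_nonneg _)).trans ?_)
    rw [← mul_div_assoc, div_le_iff₀ (by positivity)]
    nlinarith [norm_nonneg (pairing p)]
  have d2 : dist (pairing p w) (pairing p v) ≤ ε / 2 := by
    rw [dist_comm, dist_eq_norm]
    refine ContinuousLinearMap.opNorm_le_bound _ (by positivity) fun φ => ?_
    have e1 : pairing p v φ = ∫ x in Ω.carrier, k x * φ x := by
      rw [pairing_apply]
      exact integral_congr_ae (hvk.mono fun x hx => by simp only [hx])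
    have e2 : pairing p w φ = ∫ x in Ω.carrier, h x * φ x := by
      rw [pairing_apply]
      exact integral_congr_ae (hwh.mono fun x hx => by simp only [hx])
    rw [sub_apply, e1, e2]
    refine (norm_integral_mollify_sub_le φ.isWeakGradient
      (Sobolev.toLebesgue p φ).integrable φ.grad.integrable hh hhc hhM η hthick).trans ?_
    calc r * M * ∫ x in Ω.carrier, ‖φ.grad x‖ ≤ r * M * (2 * C * ‖φ.grad‖) := by
          gcongr
          exact φ.grad.integral_norm_le
      _ = r * M * (2 * C) * ‖φ.grad‖ := by ring
      _ ≤ ε / 2 * ‖φ‖ := by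
          gcongr
          rw [Sobolev.norm_def]
          exact le_add_of_nonneg_left (norm_nonneg _)
  linarith [dist_triangle (pairing p g) (pairing p w) (pairing p v)]

end LocalRellich


/-! ### The superposition operator from `L^{p(x)} × L^{p(x)}` to `L^{p'(x)}`. -/

section Nemytskii

variable {N : ℕ} {Ω : LipDomain N}

/-- Approximate `v` by simple functions. Each takes finitely many values, so only finitely many
exceptional null sets of `f(·, b)` intervene at each stage; continuity in the second variable
handles the limit. -/
theorem aemeasurable_caratheodory_comp {α β : Type*} [MeasurableSpace α] [TopologicalSpace β]
    {μ : Measure α} {f : α → β → ℝ} (hf : ∀ b, AEMeasurable (fun x => f x b) μ)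
    (hc : ∀ᵐ x ∂μ, Continuous (f x)) {v : α → β} (hv : AEStronglyMeasurable v μ) :
    AEMeasurable (fun x => f x (v x)) μ := by
  set s := hv.stronglyMeasurable_mk.approx
  have hs : ∀ n, AEMeasurable (fun x => f x (s n x)) μ := by
    intro n
    refine ⟨fun x => (hf (s n x)).mk _ x,
      SimpleFunc.measurable_bind (s n) (fun b => (hf b).mk _) fun b => (hf b).measurable_mk, ?_⟩
    have : ∀ᵐ x ∂μ, ∀ b ∈ (s n).range, f x b = (hf b).mk _ x :=
      (ae_ball_iff (s n).range.countable_toSet).2 fun b _ => (hf b).ae_eq_mk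
    exact this.mono fun x hx => hx _ (SimpleFunc.mem_range_self _ _)
  refine aemeasurable_of_tendsto_metrizable_ae atTop hs ?_
  filter_upwards [hc, hv.ae_eq_mk] with x hx hvx
  rw [hvx]
  exact (hx.tendsto _).comp (hv.stronglyMeasurable_mk.tendsto_approx x)

theorem IsCaratheodory.aestronglyMeasurable_comp {f : Rn N → ℝ → Rn N → ℝ}
    (hf : IsCaratheodory Ω f) {a : Rn N → ℝ} {b : Rn N → Rn N}
    (ha : AEStronglyMeasurable a Ω.vol) (hb : AEStronglyMeasurable b Ω.vol) :
    AEStronglyMeasurable (fun x => f x (a x) (b x)) Ω.vol :=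
  (aemeasurable_caratheodory_comp (f := fun x (z : ℝ × Rn N) => f x z.1 z.2)
    (fun z => hf.1 z.1 z.2) hf.2 (ha.prodMk hb)).aestronglyMeasurable

/-! ### Elementary inequalities -/

theorem add_rpow_le_two_rpow_mul {a b r P : ℝ} (ha : 0 ≤ a) (hb : 0 ≤ b) (hr : 0 ≤ r)
    (hP : r ≤ P) : (a + b) ^ r ≤ 2 ^ P * (a ^ r + b ^ r) := by
  have h1 : a + b ≤ 2 * max a b := by
    linarith [le_max_left a b, le_max_right a b]
  have h2 : max a b ^ r ≤ a ^ r + b ^ r := by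
    rcases max_cases a b with h | h <;> rw [h.1]
    · exact le_add_of_nonneg_right (by positivity)
    · exact le_add_of_nonneg_left (by positivity)
  calc (a + b) ^ r ≤ (2 * max a b) ^ r := Real.rpow_le_rpow (by positivity) h1 hr
    _ = 2 ^ r * max a b ^ r := Real.mul_rpow (by norm_num) (by positivity)
    _ ≤ 2 ^ P * (a ^ r + b ^ r) := by
        gcongr
        norm_num

/-- The constant `A ≥ 1` is also the threshold: below it `s ^ σ ≤ A`, above it `s ^ σ ≤ s ^ (σ₀ - 1)
* s ≤ η * s`. It depends on `σ₀` alone, which gives uniformity for an exponent varying with `x`. -/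
theorem exists_rpow_le_mul_add {σ₀ : ℝ} (hσ₀ : σ₀ < 1) {η : ℝ} (hη : 0 < η) :
    ∃ A : ℝ, 0 ≤ A ∧ ∀ σ s : ℝ, 0 < σ → σ ≤ σ₀ → 0 ≤ s → s ^ σ ≤ η * s + A := by
  have hlim : Tendsto (fun A : ℝ => A ^ (-(1 - σ₀))) atTop (𝓝 0) :=
    tendsto_rpow_neg_atTop (by linarith)
  obtain ⟨A, hA, hA1⟩ := ((hlim.eventually_le_const hη).and (eventually_ge_atTop 1)).exists
  refine ⟨A, by linarith, fun σ s h0 h1 hs => ?_⟩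
  rcases le_total s A with h | h
  · have : s ^ σ ≤ A := by
      calc s ^ σ ≤ A ^ σ := Real.rpow_le_rpow hs h h0.le
        _ ≤ A ^ (1 : ℝ) := Real.rpow_le_rpow_of_exponent_le hA1 (by linarith)
        _ = A := Real.rpow_one A
    have : 0 ≤ η * s := by positivity
    linarith
  · have hs0 : 0 < s := by linarith
    have : s ^ σ ≤ η * s := by
      calc s ^ σ ≤ s ^ (-(1 - σ₀) + 1) :=
            Real.rpow_le_rpow_of_exponent_le (by linarith) (by linarith)
        _ = s ^ (-(1 - σ₀)) * s := by rw [Real.rpow_add hs0, Real.rpow_one]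
        _ ≤ A ^ (-(1 - σ₀)) * s := by
            gcongr ?_ * s
            exact Real.rpow_le_rpow_of_nonpos (by linarith) h (by linarith)
        _ ≤ η * s := by gcongr
    linarith

theorem tendsto_zero_of_rpow {ι : Type*} {l : Filter ι} {a : ι → ℝ} (ha : ∀ i, 0 ≤ a i) {r : ℝ}
    (hr : 0 < r) (h : Tendsto (fun i => a i ^ r) l (𝓝 0)) : Tendsto a l (𝓝 0) := by
  have := h.rpow_const (p := r⁻¹) (Or.inr (by positivity))
  rw [Real.zero_rpow (by positivity)] at this
  exact this.congr fun i => Real.rpow_rpow_inv (ha i) hr.ne'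

/-! ### Growth of the superposition operator -/

/-- The growth condition in modular form: `|f(x,ζ,ξ)|^{p'(x)}` is sublinear in
`|ζ|^{p(x)} + |ξ|^{p(x)}`, up to an integrable function of `x`. -/
structure GrowthBound (p : CPlus Ω) (f : Rn N → ℝ → Rn N → ℝ) (G : Rn N → ℝ) : Prop where
  integrable : Integrable G Ω.vol
  nonneg : ∀ x, 0 ≤ G x
  bound : ∀ η : ℝ, 0 < η → ∃ A : ℝ, 0 ≤ A ∧ ∀ᵐ x ∂Ω.vol, ∀ (ζ : ℝ) (ξ : Rn N),
    |f x ζ ξ| ^ p.conj x ≤ G x + η * (|ζ| ^ p x + ‖ξ‖ ^ p x) + A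

theorem Lebesgue.integrable_norm_rpow {F : Type*} [NormedAddCommGroup F] [NormedSpace ℝ F]
    {p : CPlus Ω} (u : Lebesgue F p) : Integrable (fun x => ‖u x‖ ^ p x) Ω.vol := by
  refine ⟨(u.aestronglyMeasurable.norm.aemeasurable.pow p.aemeasurable).aestronglyMeasurable, ?_⟩
  rw [hasFiniteIntegral_iff_ofReal (Eventually.of_forall fun x => by positivity)]
  exact u.modular_lt_top

/-- As `(q - 1) p' = p (q - 1)/(p - 1)`, the growth terms raised to the power `p'` are powers of
`|ζ|^p` and `|ξ|^p` with exponent at most `(q⁺ - 1)/(p⁻ - 1)`. The gap `q⁺ < p⁻` keeps this below 1.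
-/
theorem HasGrowth.exists_growthBound {p : CPlus Ω} {f : Rn N → ℝ → Rn N → ℝ}
    (hf : HasGrowth p f) : ∃ G, GrowthBound p f G := by
  obtain ⟨β, γ, q, hβ, hq2, hqp, hb⟩ := hf
  set P := p.conj.upper
  set C := (2 : ℝ) ^ P
  set D := max 1 β ^ P
  have hC : 0 < C := by positivity
  have hD : 0 < D := by positivity
  refine ⟨fun x => D * (C * (C * |γ x| ^ p.conj x)),
    ((γ.integrable_norm_rpow.const_mul C).const_mul C).const_mul D,
    fun x => by positivity, fun η hη => ?_⟩
  have hql : ∀ᵐ x ∂Ω.vol, 2 ≤ q x ∧ q x ≤ q.upper ∧ p.lower ≤ p x := by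
    refine (ae_restrict_mem Ω.isOpen.measurableSet).mono fun x hx => ?_
    have := subset_closure hx
    exact ⟨hq2.trans (q.lower_le this), q.le_upper this, p.lower_le this⟩
  have hqu : 2 ≤ q.upper := by
    obtain ⟨x, hx⟩ := Ω.isConnected.nonempty
    have := subset_closure hx
    exact hq2.trans ((q.lower_le this).trans (q.le_upper this))
  have hσ₀ : (q.upper - 1) / (p.lower - 1) < 1 := by
    rw [div_lt_one (by linarith)]; linarith
  -- The divisor compensates the factor `D` from `β` and the two factors `C` from splitting a sum of
  -- three terms.
  obtain ⟨A, hA, hA'⟩ := exists_rpow_le_mul_add hσ₀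
    (η := η / (D * (C * C))) (by positivity)
  refine ⟨D * (C * C) * (A + A), by positivity, ?_⟩
  filter_upwards [hb, hql, p.ae_bounds, p.conj.ae_bounds] with x hx hq hp hp' ζ ξ
  have hσ : 0 < (q x - 1) / (p x - 1) := div_pos (by linarith [hq.1]) (by linarith)
  have hσ' : (q x - 1) / (p x - 1) ≤ (q.upper - 1) / (p.lower - 1) :=
    div_le_div₀ (by linarith) (by linarith [hq.2.1]) (by linarith) (by linarith [hq.2.2])
  have key : ∀ s : ℝ, 0 ≤ s → (s ^ (q x - 1)) ^ p.conj x ≤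
      η / (D * (C * C)) * s ^ p x + A := by
    intro s hs
    have e : (s ^ (q x - 1)) ^ p.conj x = (s ^ p x) ^ ((q x - 1) / (p x - 1)) := by
      rw [← Real.rpow_mul hs, ← Real.rpow_mul hs]
      congr 1
      change (q x - 1) * (p x / (p x - 1)) = _
      ring
    rw [e]
    exact hA' _ _ hσ hσ' (by positivity)
  have hpc : 0 ≤ p.conj x := by linarith
  have h1 : |f x ζ ξ| ≤ β * (|γ x| + (|ζ| ^ (q x - 1) + ‖ξ‖ ^ (q x - 1))) := by
    refine (hx ζ ξ).trans (mul_le_mul_of_nonneg_left ?_ hβ.le)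
    linarith [le_abs_self (γ x)]
  calc |f x ζ ξ| ^ p.conj x
      ≤ (β * (|γ x| + (|ζ| ^ (q x - 1) + ‖ξ‖ ^ (q x - 1)))) ^ p.conj x :=
        Real.rpow_le_rpow (abs_nonneg _) h1 hpc
    _ = β ^ p.conj x * (|γ x| + (|ζ| ^ (q x - 1) + ‖ξ‖ ^ (q x - 1))) ^ p.conj x :=
        Real.mul_rpow hβ.le (by positivity)
    _ ≤ D * (C * (|γ x| ^ p.conj x + C * ((|ζ| ^ (q x - 1)) ^ p.conj x +
          (‖ξ‖ ^ (q x - 1)) ^ p.conj x))) := by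
        gcongr
        · exact rpow_le_max_rpow p.conj hp' hβ.le
        · refine (add_rpow_le_two_rpow_mul (abs_nonneg _) (by positivity) hpc hp'.2).trans ?_
          gcongr
          exact add_rpow_le_two_rpow_mul (by positivity) (by positivity) hpc hp'.2
    _ ≤ D * (C * (C * |γ x| ^ p.conj x + C * ((η / (D * (C * C)) * |ζ| ^ p x + A) +
          (η / (D * (C * C)) * ‖ξ‖ ^ p x + A)))) := by
        gcongr
        · refine le_mul_of_one_le_left (by positivity) ?_
          exact Real.one_le_rpow (by norm_num) (by linarith)
        · exact key _ (abs_nonneg _)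
        · exact key _ (norm_nonneg _)
    _ = D * (C * (C * |γ x| ^ p.conj x)) + η * (|ζ| ^ p x + ‖ξ‖ ^ p x) +
          D * (C * C) * (A + A) := by
        field_simp
        ring

/-- Integrated form of the growth bound, on subsets of `Ω`. -/
theorem setLIntegral_growth_le {p : CPlus Ω} {f : Rn N → ℝ → Rn N → ℝ} {G : Rn N → ℝ}
    (hG : ∀ x, 0 ≤ G x) (hGm : AEMeasurable G Ω.vol) {η A : ℝ} (hη : 0 ≤ η) (hA : 0 ≤ A)
    (hb : ∀ᵐ x ∂Ω.vol, ∀ (ζ : ℝ) (ξ : Rn N),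
      |f x ζ ξ| ^ p.conj x ≤ G x + η * (|ζ| ^ p x + ‖ξ‖ ^ p x) + A)
    (a : Lebesgue ℝ p) (b : Lebesgue (Rn N) p) (E : Set (Rn N)) :
    ∫⁻ x in E, ENNReal.ofReal (|f x (a x) (b x)| ^ p.conj x) ∂Ω.vol ≤
      (∫⁻ x in E, ENNReal.ofReal (G x) ∂Ω.vol) +
        ENNReal.ofReal η * (modular p a + modular p b) + ENNReal.ofReal A * Ω.vol E := by
  have m1 := modular_aemeasurable p a.aestronglyMeasurable
  have m2 := modular_aemeasurable p b.aestronglyMeasurable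
  calc ∫⁻ x in E, ENNReal.ofReal (|f x (a x) (b x)| ^ p.conj x) ∂Ω.vol
      ≤ ∫⁻ x in E, (ENNReal.ofReal (G x) + ENNReal.ofReal η * (ENNReal.ofReal (‖a x‖ ^ p x) +
          ENNReal.ofReal (‖b x‖ ^ p x)) + ENNReal.ofReal A) ∂Ω.vol := by
        refine lintegral_mono_ae ?_
        filter_upwards [ae_restrict_of_ae hb] with x hx
        have := hG x
        rw [← ENNReal.ofReal_add (by positivity) (by positivity), ← ENNReal.ofReal_mul hη,
          ← ENNReal.ofReal_add (by positivity) (by positivity),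
          ← ENNReal.ofReal_add (by positivity) (by positivity)]
        exact ENNReal.ofReal_le_ofReal (hx _ _)
    _ = (∫⁻ x in E, ENNReal.ofReal (G x) ∂Ω.vol) + ENNReal.ofReal η *
          ((∫⁻ x in E, ENNReal.ofReal (‖a x‖ ^ p x) ∂Ω.vol) +
            ∫⁻ x in E, ENNReal.ofReal (‖b x‖ ^ p x) ∂Ω.vol) + ENNReal.ofReal A * Ω.vol E := by
        rw [lintegral_add_right _ measurable_const, lintegral_add_left' hGm.ennreal_ofReal.restrict,
          lintegral_const_mul' _ _ ENNReal.ofReal_ne_top, lintegral_add_left' m1.restrict,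
          setLIntegral_const]
    _ ≤ _ := by
        gcongr
        · exact setLIntegral_le_lintegral _ _
        · exact setLIntegral_le_lintegral _ _

theorem GrowthBound.modular_lt_top {p : CPlus Ω} {f : Rn N → ℝ → Rn N → ℝ} {G : Rn N → ℝ}
    (h : GrowthBound p f G) (a : Lebesgue ℝ p) (b : Lebesgue (Rn N) p) :
    modular p.conj (fun x => f x (a x) (b x)) < ⊤ := by
  obtain ⟨A, hA, hb⟩ := h.bound 1 one_pos
  have := setLIntegral_growth_le h.nonneg h.integrable.aemeasurable zero_le_one hA hb a b univ
  rw [Measure.restrict_univ] at this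
  refine this.trans_lt (ENNReal.add_lt_top.2 ⟨ENNReal.add_lt_top.2 ⟨?_, ?_⟩, ?_⟩)
  · exact (hasFiniteIntegral_iff_ofReal (Eventually.of_forall h.nonneg)).1 h.integrable.2
  · exact ENNReal.mul_lt_top ENNReal.ofReal_lt_top
      (ENNReal.add_lt_top.2 ⟨a.modular_lt_top, b.modular_lt_top⟩)
  · exact ENNReal.mul_lt_top ENNReal.ofReal_lt_top (measure_lt_top _ _)

/-- The superposition operator `(a, b) ↦ f(x, a(x), b(x))` from `L^{p(x)} × L^{p(x)}` to
`L^{p'(x)}`. -/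
def nemytskii {p : CPlus Ω} {f : Rn N → ℝ → Rn N → ℝ} (hf : IsCaratheodory Ω f) {G : Rn N → ℝ}
    (hG : GrowthBound p f G) (a : Lebesgue ℝ p) (b : Lebesgue (Rn N) p) : Lebesgue ℝ p.conj :=
  Lebesgue.mk (fun x => f x (a x) (b x))
    (hf.aestronglyMeasurable_comp a.aestronglyMeasurable b.aestronglyMeasurable)
    (hG.modular_lt_top a b)

theorem coeFn_nemytskii {p : CPlus Ω} {f : Rn N → ℝ → Rn N → ℝ} (hf : IsCaratheodory Ω f)
    {G : Rn N → ℝ} (hG : GrowthBound p f G) (a : Lebesgue ℝ p) (b : Lebesgue (Rn N) p) :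
    ⇑(nemytskii hf hG a b) =ᵐ[Ω.vol] fun x => f x (a x) (b x) := Lebesgue.coeFn_mk _ _ _

/-! ### Continuity of the superposition operator -/

theorem exists_subseq_tendsto_ae_of_lintegral {α : Type*} [MeasurableSpace α] {μ : Measure α}
    {e : ℕ → α → ℝ} (hm : ∀ n, AEMeasurable (e n) μ) (h0 : ∀ n x, 0 ≤ e n x)
    (h : Tendsto (fun n => ∫⁻ x, ENNReal.ofReal (e n x) ∂μ) atTop (𝓝 0)) :
    ∃ ns : ℕ → ℕ, StrictMono ns ∧ ∀ᵐ x ∂μ, Tendsto (fun i => e (ns i) x) atTop (𝓝 0) := by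
  have : TendstoInMeasure μ e atTop (fun _ => (0 : ℝ)) := by
    refine tendstoInMeasure_of_tendsto_eLpNorm one_ne_zero
      (fun n => (hm n).aestronglyMeasurable) aestronglyMeasurable_const (h.congr fun n => ?_)
    rw [eLpNorm_one_eq_lintegral_enorm]
    refine lintegral_congr fun x => ?_
    simp [Real.enorm_eq_ofReal (h0 n x)]
  exact this.exists_seq_tendsto_ae

/-- Dominated convergence with a dominating function that varies: `d ≤ min d B + e`, where the first
term is dominated by `B` and the second vanishes in the limit. -/
theorem tendsto_lintegral_zero_of_le_add {α : Type*} [MeasurableSpace α] {μ : Measure α}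
    {d e : ℕ → α → ENNReal} {B : α → ENNReal} (hd : ∀ n, AEMeasurable (d n) μ)
    (hBm : AEMeasurable B μ) (hB : ∫⁻ x, B x ∂μ ≠ ⊤) (hde : ∀ n, ∀ᵐ x ∂μ, d n x ≤ B x + e n x)
    (hlim : ∀ᵐ x ∂μ, Tendsto (fun n => d n x) atTop (𝓝 0))
    (he : Tendsto (fun n => ∫⁻ x, e n x ∂μ) atTop (𝓝 0)) :
    Tendsto (fun n => ∫⁻ x, d n x ∂μ) atTop (𝓝 0) := by
  have h1 : Tendsto (fun n => ∫⁻ x, min (d n x) (B x) ∂μ) atTop (𝓝 0) := by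
    have := tendsto_lintegral_of_dominated_convergence' (μ := μ) (f := fun _ => 0)
      (F := fun n x => min (d n x) (B x)) B (fun n => (hd n).min hBm)
      (fun n => Eventually.of_forall fun x => min_le_right _ _) hB
      (hlim.mono fun x hx => by simpa using hx.min (tendsto_const_nhds (x := B x)))
    simpa using this
  refine tendsto_of_tendsto_of_tendsto_of_le_of_le tendsto_const_nhds
    (by simpa using h1.add he) (fun n => zero_le) fun n => ?_
  change ∫⁻ x, d n x ∂μ ≤ (∫⁻ x, min (d n x) (B x) ∂μ) + ∫⁻ x, e n x ∂μ
  rw [← lintegral_add_left' ((hd n).min hBm)]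
  refine lintegral_mono_ae ((hde n).mono fun x hx => ?_)
  rcases le_total (d n x) (B x) with h | h
  · rw [min_eq_left h]; exact le_self_add
  · rw [min_eq_right h]; exact hx

theorem tendsto_nemytskii {p : CPlus Ω} {f : Rn N → ℝ → Rn N → ℝ} (hf : IsCaratheodory Ω f)
    {G : Rn N → ℝ} (hG : GrowthBound p f G) {a : ℕ → Lebesgue ℝ p} {b : ℕ → Lebesgue (Rn N) p}
    {a₀ : Lebesgue ℝ p} {b₀ : Lebesgue (Rn N) p} (ha : Tendsto a atTop (𝓝 a₀))
    (hb : Tendsto b atTop (𝓝 b₀)) :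
    Tendsto (fun n => nemytskii hf hG (a n) (b n)) atTop (𝓝 (nemytskii hf hG a₀ b₀)) := by
  have Ta : Tendsto (fun n => modular p ⇑(a n - a₀)) atTop (𝓝 0) :=
    tendsto_modular_of_tendsto_norm (tendsto_iff_norm_sub_tendsto_zero.1 ha)
  have Tb : Tendsto (fun n => modular p ⇑(b n - b₀)) atTop (𝓝 0) :=
    tendsto_modular_of_tendsto_norm (tendsto_iff_norm_sub_tendsto_zero.1 hb)
  set e : ℕ → Rn N → ℝ := fun n x => ‖(a n - a₀) x‖ ^ p x + ‖(b n - b₀) x‖ ^ p x with he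
  have he0 : ∀ n x, 0 ≤ e n x := fun n x => by positivity
  have hem : ∀ n, AEMeasurable (e n) Ω.vol := fun n =>
    (Lebesgue.integrable_norm_rpow _).aemeasurable.add
      (Lebesgue.integrable_norm_rpow _).aemeasurable
  have Te : Tendsto (fun n => ∫⁻ x, ENNReal.ofReal (e n x) ∂Ω.vol) atTop (𝓝 0) := by
    have := Ta.add Tb
    rw [add_zero] at this
    refine this.congr fun n => ?_
    unfold modular
    rw [← lintegral_add_left' (modular_aemeasurable p (Lebesgue.aestronglyMeasurable _))]
    refine lintegral_congr fun x => ?_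
    rw [← ENNReal.ofReal_add (by positivity) (by positivity)]
  -- Norm convergence gives a.e. convergence only along subsequences, so it suffices to extract a
  -- good subsequence from every given one.
  refine tendsto_of_subseq_tendsto fun ns hns => ?_
  obtain ⟨ms, hms, hae⟩ := exists_subseq_tendsto_ae_of_lintegral (fun n => hem (ns n))
    (fun n => he0 (ns n)) (Te.comp hns)
  refine ⟨ms, tendsto_iff_norm_sub_tendsto_zero.2 (tendsto_norm_of_tendsto_modular ?_)⟩
  set ks : ℕ → ℕ := fun i => ns (ms i)
  have hks : Tendsto ks atTop atTop := hns.comp hms.tendsto_atTop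
  have hsub : ∀ᵐ x ∂Ω.vol, ∀ n, (a n - a₀) x = a n x - a₀ x ∧ (b n - b₀) x = b n x - b₀ x :=
    ae_all_iff.2 fun n => (Lebesgue.coeFn_sub (a n) a₀).and (Lebesgue.coeFn_sub (b n) b₀)
  have hmod : ∀ n, modular p.conj ⇑(nemytskii hf hG (a n) (b n) - nemytskii hf hG a₀ b₀) =
      ∫⁻ x, ENNReal.ofReal (|f x (a n x) (b n x) - f x (a₀ x) (b₀ x)| ^ p.conj x) ∂Ω.vol := by
    intro n
    refine modular_congr p.conj (v := fun x => f x (a n x) (b n x) - f x (a₀ x) (b₀ x)) ?_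
    filter_upwards [Lebesgue.coeFn_sub (nemytskii hf hG (a n) (b n)) (nemytskii hf hG a₀ b₀),
      coeFn_nemytskii hf hG (a n) (b n), coeFn_nemytskii hf hG a₀ b₀] with x h1 h2 h3
    rw [h1, h2, h3]
  change Tendsto (fun i => modular p.conj
    ⇑(nemytskii hf hG (a (ks i)) (b (ks i)) - nemytskii hf hG a₀ b₀)) atTop (𝓝 0)
  simp only [hmod]
  obtain ⟨A, hA, hbd⟩ := hG.bound 1 one_pos
  set C := (2 : ℝ) ^ p.upper
  set D := (2 : ℝ) ^ p.conj.upper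
  have hC : 0 ≤ C := by positivity
  have hD : 0 ≤ D := by positivity
  -- The part of the domination independent of `n`. Writing `a n = (a n - a₀) + a₀`, and likewise
  -- for `b`, leaves the remainder `D * C * e n`, which tends to 0 in `L¹`.
  set B : Rn N → ℝ := fun x => D * ((G x + C * (‖a₀ x‖ ^ p x + ‖b₀ x‖ ^ p x) + A) +
    ‖nemytskii hf hG a₀ b₀ x‖ ^ p.conj x) with hB
  have hBi : Integrable B Ω.vol :=
    (((hG.integrable.add ((a₀.integrable_norm_rpow.add b₀.integrable_norm_rpow).const_mul C)).add
      (integrable_const A)).add (Lebesgue.integrable_norm_rpow _)).const_mul D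
  have hB0 : ∀ x, 0 ≤ B x := fun x => by
    have := hG.nonneg x
    positivity
  refine tendsto_lintegral_zero_of_le_add (B := fun x => ENNReal.ofReal (B x))
    (e := fun i x => ENNReal.ofReal (D * C) * ENNReal.ofReal (e (ks i) x)) (fun n => ?_)
    hBi.aemeasurable.ennreal_ofReal ?_ (fun n => ?_) ?_ ?_
  · refine modular_aemeasurable p.conj
      (u := fun x => f x (a (ks n) x) (b (ks n) x) - f x (a₀ x) (b₀ x)) ?_
    exact (hf.aestronglyMeasurable_comp (Lebesgue.aestronglyMeasurable _)
      (Lebesgue.aestronglyMeasurable _)).sub (hf.aestronglyMeasurable_comp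
      (Lebesgue.aestronglyMeasurable _) (Lebesgue.aestronglyMeasurable _))
  · exact ((hasFiniteIntegral_iff_ofReal (Eventually.of_forall hB0)).1 hBi.2).ne
  · filter_upwards [hbd, hsub, p.ae_bounds, p.conj.ae_bounds, coeFn_nemytskii hf hG a₀ b₀]
      with x hx hs hp hp' hN
    rw [← ENNReal.ofReal_mul (by positivity), ← ENNReal.ofReal_add (hB0 x)
      (mul_nonneg (by positivity) (he0 _ _))]
    apply ENNReal.ofReal_le_ofReal
    have t1 : |a (ks n) x| ^ p x ≤ C * (‖(a (ks n) - a₀) x‖ ^ p x + ‖a₀ x‖ ^ p x) := by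
      refine le_trans ?_ (add_rpow_le_two_rpow_mul (norm_nonneg _) (norm_nonneg _)
        (by linarith) hp.2)
      refine Real.rpow_le_rpow (abs_nonneg _) ?_ (by linarith)
      rw [(hs _).1]
      simpa using norm_add_le (a (ks n) x - a₀ x) (a₀ x)
    have t2 : ‖b (ks n) x‖ ^ p x ≤ C * (‖(b (ks n) - b₀) x‖ ^ p x + ‖b₀ x‖ ^ p x) := by
      refine le_trans ?_ (add_rpow_le_two_rpow_mul (norm_nonneg _) (norm_nonneg _)
        (by linarith) hp.2)
      refine Real.rpow_le_rpow (norm_nonneg _) ?_ (by linarith)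
      rw [(hs _).2]
      simpa using norm_add_le (b (ks n) x - b₀ x) (b₀ x)
    calc |f x (a (ks n) x) (b (ks n) x) - f x (a₀ x) (b₀ x)| ^ p.conj x
        ≤ (|f x (a (ks n) x) (b (ks n) x)| + |f x (a₀ x) (b₀ x)|) ^ p.conj x :=
          Real.rpow_le_rpow (abs_nonneg _) (abs_sub _ _) (by linarith)
      _ ≤ D * (|f x (a (ks n) x) (b (ks n) x)| ^ p.conj x +
            |f x (a₀ x) (b₀ x)| ^ p.conj x) :=
          add_rpow_le_two_rpow_mul (abs_nonneg _) (abs_nonneg _) (by linarith) hp'.2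
      _ ≤ D * ((G x + 1 * (C * (‖(a (ks n) - a₀) x‖ ^ p x + ‖a₀ x‖ ^ p x) +
            C * (‖(b (ks n) - b₀) x‖ ^ p x + ‖b₀ x‖ ^ p x)) + A) +
            ‖nemytskii hf hG a₀ b₀ x‖ ^ p.conj x) := by
          gcongr
          · refine (hx _ _).trans ?_
            gcongr
          · linarith
          · rw [hN, Real.norm_eq_abs]
      _ = B x + D * C * e (ks n) x := by
          simp only [hB, he]
          ring
  · filter_upwards [hae, hsub, p.ae_bounds, p.conj.ae_bounds, hf.2] with x hx hs hp hp' hfx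
    have c1 : Tendsto (fun i => a (ks i) x) atTop (𝓝 (a₀ x)) := by
      rw [tendsto_iff_norm_sub_tendsto_zero]
      refine tendsto_zero_of_rpow (fun i => norm_nonneg _) (r := p x) (by linarith) ?_
      refine squeeze_zero (fun i => by positivity) (fun i => ?_) hx
      rw [← (hs _).1]
      exact le_add_of_nonneg_right (by positivity)
    have c2 : Tendsto (fun i => b (ks i) x) atTop (𝓝 (b₀ x)) := by
      rw [tendsto_iff_norm_sub_tendsto_zero]
      refine tendsto_zero_of_rpow (fun i => norm_nonneg _) (r := p x) (by linarith) ?_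
      refine squeeze_zero (fun i => by positivity) (fun i => ?_) hx
      rw [← (hs _).2]
      exact le_add_of_nonneg_left (by positivity)
    have c3 : Tendsto (fun i => f x (a (ks i) x) (b (ks i) x)) atTop (𝓝 (f x (a₀ x) (b₀ x))) :=
      (hfx.tendsto (a₀ x, b₀ x)).comp (c1.prodMk_nhds c2)
    have c4 : Tendsto (fun i => |f x (a (ks i) x) (b (ks i) x) - f x (a₀ x) (b₀ x)| ^ p.conj x)
        atTop (𝓝 0) := by
      have := ((tendsto_iff_norm_sub_tendsto_zero.1 c3).rpow_const (p := p.conj x)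
        (Or.inr (by linarith)))
      rwa [Real.zero_rpow (by linarith)] at this
    simpa using ENNReal.tendsto_ofReal c4
  · have := ENNReal.Tendsto.const_mul (a := ENNReal.ofReal (D * C)) (Te.comp hks)
      (Or.inr ENNReal.ofReal_ne_top)
    rw [mul_zero] at this
    refine this.congr fun n => ?_
    rw [lintegral_const_mul' _ _ ENNReal.ofReal_ne_top]
    rfl

end Nemytskii


/-! ### Truncation of equi-integrable families, and total boundedness in the dual. -/

section CompactSuperposition

variable {N : ℕ} {Ω : LipDomain N}

/-- A bounded family in `L^{p(x)}` whose modulars over sets of small measure are small is, up to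
an arbitrarily small error, uniformly bounded and supported in a compact subset of `Ω`. -/
theorem exists_truncation {p : CPlus Ω} {H : Set (Lebesgue ℝ p)} {Q : ℝ}
    (hHQ : ∀ h ∈ H, modular p h ≤ ENNReal.ofReal Q)
    (hH : ∀ δ : ℝ, 0 < δ → ∃ θ : ℝ, 0 < θ ∧ ∀ h ∈ H, ∀ E, MeasurableSet E →
      Ω.vol E ≤ ENNReal.ofReal θ →
      ∫⁻ x in E, ENNReal.ofReal (‖h x‖ ^ p x) ∂Ω.vol ≤ ENNReal.ofReal δ)
    {ε : ℝ} (hε : 0 < ε) :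
    ∃ (K : Set (Rn N)) (M : ℝ), IsCompact K ∧ K ⊆ Ω.carrier ∧ 0 ≤ M ∧ ∀ h ∈ H,
      ∃ g : Lebesgue ℝ p, (∀ᵐ x ∂Ω.vol, |g x| ≤ M) ∧ (∀ᵐ x ∂Ω.vol, x ∉ K → g x = 0) ∧
        ‖h - g‖ ≤ ε := by
  obtain ⟨δ, hδ, hδε⟩ := exists_norm_le_of_modular_le (F := ℝ) p hε
  obtain ⟨θ, hθ, hθδ⟩ := hH δ hδ
  obtain ⟨K, hKΩ, hK, hKm⟩ := Ω.isOpen.measurableSet.exists_isCompact_sdiff_lt (μ := volume)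
    Ω.isBounded.measure_lt_top.ne (ENNReal.ofReal_pos.2 (half_pos hθ)).ne'
  -- Chebyshev's inequality: since `M ≥ 1`, `|h|^p ≥ M` where `|h| > M`, so that set has measure at
  -- most `Q / M ≤ θ / 2`. The other `θ / 2` is for `Ω \ K`.
  set M := max 1 (2 * Q / θ) with hMdef
  have hM1 : 1 ≤ M := le_max_left _ _
  have hM0 : 0 < M := by linarith
  refine ⟨K, M, hK, hKΩ, hM0.le, fun h hh => ?_⟩
  have hsm : StronglyMeasurable (h : Rn N → ℝ) := h.toAEEqFun.stronglyMeasurable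
  set E₁ : Set (Rn N) := {x | M < ‖h x‖}
  have hE₁ : MeasurableSet E₁ := measurableSet_lt measurable_const hsm.norm.measurable
  set E : Set (Rn N) := E₁ ∪ Kᶜ
  have hE : MeasurableSet E := hE₁.union hK.measurableSet.compl
  have hvE₁ : Ω.vol E₁ ≤ ENNReal.ofReal (θ / 2) := by
    have h1 : ENNReal.ofReal M * Ω.vol E₁ ≤ ENNReal.ofReal Q := by
      rw [← setLIntegral_const]
      refine le_trans ?_ ((setLIntegral_le_lintegral E₁ _).trans (hHQ h hh))
      refine lintegral_mono_ae ?_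
      filter_upwards [ae_restrict_mem hE₁, ae_restrict_of_ae p.ae_bounds] with x hx hp
      apply ENNReal.ofReal_le_ofReal
      have hx' : M < ‖h x‖ := hx
      refine hx'.le.trans ?_
      simpa using Real.rpow_le_rpow_of_exponent_le (hM1.trans hx'.le) hp.1.le
    calc Ω.vol E₁ ≤ ENNReal.ofReal Q / ENNReal.ofReal M := by
          rw [ENNReal.le_div_iff_mul_le (Or.inl (ENNReal.ofReal_pos.2 hM0).ne')
            (Or.inl ENNReal.ofReal_ne_top), mul_comm]
          exact h1
      _ = ENNReal.ofReal (Q / M) := (ENNReal.ofReal_div_of_pos hM0).symm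
      _ ≤ ENNReal.ofReal (θ / 2) := by
          apply ENNReal.ofReal_le_ofReal
          rw [div_le_iff₀ hM0]
          have : 2 * Q / θ ≤ M := le_max_right _ _
          rw [div_le_iff₀ hθ] at this
          linarith
  have hvK : Ω.vol Kᶜ ≤ ENNReal.ofReal (θ / 2) := by
    rw [Measure.restrict_apply hK.measurableSet.compl, inter_comm, ← sdiff_eq]
    exact hKm.le
  have hvE : Ω.vol E ≤ ENNReal.ofReal θ := by
    refine (measure_union_le _ _).trans ((add_le_add hvE₁ hvK).trans (le_of_eq ?_))
    rw [← ENNReal.ofReal_add (by positivity) (by positivity), add_halves]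
  have hgm : AEStronglyMeasurable (Eᶜ.indicator (h : Rn N → ℝ)) Ω.vol :=
    (hsm.indicator hE.compl).aestronglyMeasurable
  have hgb : ∀ x, |Eᶜ.indicator (h : Rn N → ℝ) x| ≤ M := by
    intro x
    by_cases hx : x ∈ Eᶜ
    · rw [indicator_of_mem hx]
      by_contra hcon
      exact hx (Or.inl (not_le.1 hcon))
    · rw [indicator_of_notMem hx, abs_zero]
      exact hM0.le
  -- Cutting `h` off to zero on `E` makes `h - g` the restriction of `h` to a set of small measure,
  -- so its modular is controlled by equi-integrability.
  set g : Lebesgue ℝ p := Lebesgue.mk (Eᶜ.indicator (h : Rn N → ℝ)) hgm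
    (modular_lt_top_of_bound p (Eventually.of_forall hgb))
  have hg : ⇑g =ᵐ[Ω.vol] Eᶜ.indicator (h : Rn N → ℝ) := Lebesgue.coeFn_mk _ _ _
  refine ⟨g, ?_, ?_, hδε _ ?_⟩
  · filter_upwards [hg] with x hx
    rw [hx]
    exact hgb x
  · filter_upwards [hg] with x hx hxK
    rw [hx, indicator_of_notMem]
    exact fun h' => h' (Or.inr hxK)
  · refine le_trans (le_of_eq ?_) (hθδ h hh E hE hvE)
    unfold modular
    rw [← lintegral_indicator hE]
    refine lintegral_congr_ae ?_
    filter_upwards [hg, Lebesgue.coeFn_sub h g, p.ae_bounds] with x h1 h2 hp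
    rw [h2, h1]
    by_cases hx : x ∈ E
    · rw [indicator_of_notMem (notMem_compl_iff.2 hx), indicator_of_mem hx, sub_zero]
    · rw [indicator_of_mem (show x ∈ Eᶜ from hx), indicator_of_notMem hx, sub_self, norm_zero,
        Real.zero_rpow (by linarith), ENNReal.ofReal_zero]

/-- The superposition operator, followed by `L^{p'(x)} → W^{-1,p'(x)}`, maps bounded sets to
totally bounded sets. -/
theorem totallyBounded_pairing_nemytskii {p : CPlus Ω} {f : Rn N → ℝ → Rn N → ℝ}
    (hf : IsCaratheodory Ω f) {G : Rn N → ℝ} (hG : GrowthBound p f G) (R : ℝ) :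
    TotallyBounded (pairing p '' {h | ∃ (a : Lebesgue ℝ p) (b : Lebesgue (Rn N) p),
      ‖a‖ < R ∧ ‖b‖ < R ∧ h = nemytskii hf hG a b}) := by
  set H := {h | ∃ (a : Lebesgue ℝ p) (b : Lebesgue (Rn N) p),
      ‖a‖ < R ∧ ‖b‖ < R ∧ h = nemytskii hf hG a b}
  set T : ℝ := max 1 R ^ p.upper
  have hT : 0 < T := by positivity
  have hGT : ∫⁻ x, ENNReal.ofReal (G x) ∂Ω.vol < ⊤ :=
    (hasFiniteIntegral_iff_ofReal (Eventually.of_forall hG.nonneg)).1 hG.integrable.2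
  have hkey : ∀ η : ℝ, 0 < η → ∃ A : ℝ, 0 ≤ A ∧ ∀ h ∈ H, ∀ E,
      ∫⁻ x in E, ENNReal.ofReal (‖h x‖ ^ p.conj x) ∂Ω.vol ≤
        (∫⁻ x in E, ENNReal.ofReal (G x) ∂Ω.vol) + ENNReal.ofReal (η * (T + T)) +
          ENNReal.ofReal A * Ω.vol E := by
    intro η hη
    obtain ⟨A, hA, hb⟩ := hG.bound η hη
    refine ⟨A, hA, ?_⟩
    rintro h ⟨a, b, ha, hb', rfl⟩ E
    have e : ∫⁻ x in E, ENNReal.ofReal (‖nemytskii hf hG a b x‖ ^ p.conj x) ∂Ω.vol =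
        ∫⁻ x in E, ENNReal.ofReal (|f x (a x) (b x)| ^ p.conj x) ∂Ω.vol := by
      refine lintegral_congr_ae (ae_restrict_of_ae ?_)
      filter_upwards [coeFn_nemytskii hf hG a b] with x hx
      rw [hx, Real.norm_eq_abs]
    rw [e]
    refine (setLIntegral_growth_le hG.nonneg hG.integrable.aemeasurable hη.le hA hb a b E).trans ?_
    rw [ENNReal.ofReal_mul hη.le, ENNReal.ofReal_add hT.le hT.le]
    gcongr
    · exact a.modular_le_of_norm_lt ha
    · exact b.modular_le_of_norm_lt hb'
  obtain ⟨Q, hHQ⟩ : ∃ Q : ℝ, ∀ h ∈ H, modular p.conj h ≤ ENNReal.ofReal Q := by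
    obtain ⟨A, hA, hb⟩ := hkey 1 one_pos
    set W := (∫⁻ x, ENNReal.ofReal (G x) ∂Ω.vol) + ENNReal.ofReal (1 * (T + T)) +
          ENNReal.ofReal A * Ω.vol univ
    have hW : W ≠ ⊤ := (ENNReal.add_lt_top.2 ⟨ENNReal.add_lt_top.2 ⟨hGT, ENNReal.ofReal_lt_top⟩,
      ENNReal.mul_lt_top ENNReal.ofReal_lt_top (measure_lt_top _ _)⟩).ne
    refine ⟨W.toReal, fun h hh => ?_⟩
    rw [ENNReal.ofReal_toReal hW]
    simpa [modular, W] using hb h hh univ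
  have hH : ∀ δ : ℝ, 0 < δ → ∃ θ : ℝ, 0 < θ ∧ ∀ h ∈ H, ∀ E, MeasurableSet E →
      Ω.vol E ≤ ENNReal.ofReal θ →
      ∫⁻ x in E, ENNReal.ofReal (‖h x‖ ^ p.conj x) ∂Ω.vol ≤ ENNReal.ofReal δ := by
    intro δ hδ
    -- The order of choices matters: `η` first, so that the contribution of `a` and `b` is `δ / 3`
    -- on any set; this fixes `A`, and only then is the measure of `E` made small against `G` and
    -- `A`.
    obtain ⟨A, hA, hb⟩ := hkey (δ / 3 / (T + T)) (by positivity)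
    obtain ⟨κ, hκ, hκG⟩ := exists_pos_setLIntegral_lt_of_measure_lt hGT.ne
      (ENNReal.ofReal_pos.2 (show 0 < δ / 3 by positivity)).ne'
    obtain ⟨κ', hκ'0, hκ'⟩ : ∃ t : ℝ, 0 < t ∧ ENNReal.ofReal t < κ := by
      obtain ⟨r, h0, hr⟩ := ENNReal.lt_iff_exists_nnreal_btwn.1 hκ
      exact ⟨r, by simpa using h0, by simpa using hr⟩
    refine ⟨min κ' (δ / 3 / (A + 1)), by positivity, fun h hh E hE hEθ => ?_⟩
    have h1 : ∫⁻ x in E, ENNReal.ofReal (G x) ∂Ω.vol ≤ ENNReal.ofReal (δ / 3) :=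
      (hκG E (hEθ.trans_lt ((ENNReal.ofReal_le_ofReal (min_le_left _ _)).trans_lt hκ'))).le
    have h2 : ENNReal.ofReal A * Ω.vol E ≤ ENNReal.ofReal (δ / 3) := by
      calc ENNReal.ofReal A * Ω.vol E ≤ ENNReal.ofReal A * ENNReal.ofReal (δ / 3 / (A + 1)) := by
            gcongr
            exact hEθ.trans (ENNReal.ofReal_le_ofReal (min_le_right _ _))
        _ = ENNReal.ofReal (A * (δ / 3 / (A + 1))) := (ENNReal.ofReal_mul hA).symm
        _ ≤ ENNReal.ofReal (δ / 3) := by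
            apply ENNReal.ofReal_le_ofReal
            rw [← mul_div_assoc, div_le_iff₀ (by positivity)]
            nlinarith
    refine (hb h hh E).trans ?_
    rw [div_mul_cancel₀ _ (by positivity)]
    refine (add_le_add (add_le_add h1 le_rfl) h2).trans (le_of_eq ?_)
    rw [← ENNReal.ofReal_add (by positivity) (by positivity),
      ← ENNReal.ofReal_add (by positivity) (by positivity)]
    congr 1
    ring
  refine totallyBounded_of_approx fun ε hε => ?_
  obtain ⟨K, M, hK, hKΩ, hM, hKM⟩ := exists_truncation hHQ hH
    (ε := ε / (‖pairing p‖ + 1)) (by positivity)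
  refine ⟨_, totallyBounded_pairing_image p hK hKΩ hM, ?_⟩
  rintro _ ⟨h, hh, rfl⟩
  obtain ⟨g, hgM, hgK, hhg⟩ := hKM h hh
  refine ⟨pairing p g, ⟨g, ⟨hgM, hgK⟩, rfl⟩, ?_⟩
  rw [dist_eq_norm, ← map_sub]
  refine ((pairing p).le_opNorm _).trans
    ((mul_le_mul_of_nonneg_left hhg (norm_nonneg _)).trans ?_)
  rw [← mul_div_assoc, div_le_iff₀ (by positivity)]
  nlinarith [norm_nonneg (pairing p)]

theorem Sobolev.norm_toLebesgue_le {p : CPlus Ω} (u : Sobolev p) : ‖toLebesgue p u‖ ≤ ‖u‖ := by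
  rw [Sobolev.norm_def]
  exact le_add_of_nonneg_right (norm_nonneg _)

theorem Sobolev.norm_grad_le {p : CPlus Ω} (u : Sobolev p) : ‖u.grad‖ ≤ ‖u‖ := by
  rw [Sobolev.norm_def]
  exact le_add_of_nonneg_left (norm_nonneg _)

theorem Sobolev.continuous_toLebesgue (p : CPlus Ω) : Continuous (toLebesgue p) :=
  ((toLebesgue p).mkContinuous 1 fun u => by
    rw [one_mul]; exact u.norm_toLebesgue_le).continuous

theorem Sobolev.continuous_grad (p : CPlus Ω) : Continuous (Sobolev.grad : Sobolev p → _) :=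
  (LinearMap.mkContinuous (⟨⟨Sobolev.grad, Sobolev.grad_add⟩, Sobolev.grad_smul⟩ :
    Sobolev p →ₗ[ℝ] Lebesgue (Rn N) p) 1 fun u => by
      rw [one_mul]; exact u.norm_grad_le).continuous

end CompactSuperposition

end VarExp

end

/-! ### Assembly of the operator from the superposition operator and the pairing. -/

theorem lemma4p5 {N : ℕ} (hN : 2 ≤ N) (Ω : VarExp.LipDomain N) (p : VarExp.CPlus Ω)
    (hlog : p.LogHolder) (hp : 2 ≤ p.lower) (f : VarExp.Rn N → ℝ → VarExp.Rn N → ℝ)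
    (hA1 : VarExp.IsCaratheodory Ω f) (hA2 : VarExp.HasGrowth p f) (lam : ℝ) :
    ∃ S : VarExp.Sobolev p → VarExp.DualSobolev p,
      (∀ u φ : VarExp.Sobolev p,
        Integrable (fun x => lam * f x (u x) (u.grad x) * φ x) Ω.vol ∧
          S u φ = -∫ x in Ω.carrier, lam * f x (u x) (u.grad x) * φ x) ∧
      VarExp.IsCompactMap S := by
  obtain ⟨G, hG⟩ := hA2.exists_growthBound
  let T : VarExp.Sobolev p → VarExp.Lebesgue ℝ p.conj := fun u =>
    VarExp.nemytskii hA1 hG (VarExp.Sobolev.toLebesgue p u) u.grad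
  have hT : ∀ u, ⇑(T u) =ᵐ[Ω.vol] fun x => f x (u x) (u.grad x) := fun u =>
    VarExp.coeFn_nemytskii hA1 hG _ _
  have hTc : Continuous T := by
    refine continuous_iff_seqContinuous.2 fun v u hv => ?_
    exact VarExp.tendsto_nemytskii hA1 hG
      (((VarExp.Sobolev.continuous_toLebesgue p).tendsto u).comp hv)
      (((VarExp.Sobolev.continuous_grad p).tendsto u).comp hv)
  have hae : ∀ u φ : VarExp.Sobolev p, (fun x => lam * (T u x * φ x)) =ᵐ[Ω.vol]
      fun x => lam * f x (u x) (u.grad x) * φ x := fun u φ => by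
    filter_upwards [hT u] with x hx
    rw [hx, mul_assoc]
  refine ⟨fun u => (-lam) • VarExp.pairing p (T u), fun u φ => ⟨?_, ?_⟩, ?_, fun B hB => ?_⟩
  · exact ((VarExp.integrable_mul (T u) (VarExp.Sobolev.toLebesgue p φ)).const_mul lam).congr
      (hae u φ)
  · rw [← integral_congr_ae (hae u φ), integral_const_mul, ← neg_mul]
    rfl
  · exact ((VarExp.pairing p).continuous.comp hTc).const_smul (-lam)
  · obtain ⟨R, hR⟩ := hB.exists_norm_le
    -- The radius `R + 1` provides the strict inequalities. In the complete dual space, the closure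
    -- of a totally bounded set is compact.
    have hTB := (VarExp.totallyBounded_pairing_nemytskii hA1 hG (R + 1)).image
      (uniformContinuous_const_smul (-lam))
    refine TotallyBounded.isCompact_of_isClosed (TotallyBounded.closure (hTB.subset ?_))
      isClosed_closure
    rintro _ ⟨u, hu, rfl⟩
    have hu' := hR u hu
    refine ⟨_, ⟨T u, ⟨_, _, ?_, ?_, rfl⟩, rfl⟩, rfl⟩
    · linarith [u.norm_toLebesgue_le]
    · linarith [u.norm_grad_le]
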